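/- Let $\mathbb{C}\{t,z]]$ be the ring of formal power series $\sum_{n\ge 0}a_n z^n$ whose coefficients $a_n=a_n(t_1,\dots,t_m)$ are all holomorphic on one common neighbourhood of $0\in\mathbb{C}^m$. A formal $(TE)$-structure $\nabla$ of rank $r$ over $(\mathbb{C}^m,0)$ is a connection form $\sum_i z^{-1}A_i\,dt_i+z^{-2}B\,dz$ with $A_i,B\in M_{r\times r}(\mathbb{C}\{t,z]])$ which is flat: $$z\partial_iA_j-z\partial_jA_i+[A_i,A_j]=0,\qquad z\partial_iB-z^2\partial_zA_i+zA_i+[A_i,B]=0 .$$ A formal isomorphism between $\nabla=(A_i,B)$ and $\tilde\nabla=(\tilde A_i,\tilde B)$ which covers a biholomorphic germ $h=(h^1,\dots,h^m):(\mathbb{C}^m,0)\to(\mathbb{C}^m,0)$ is a matrix $T=\sum_{n\ge0}T^{(n)}z^n\in M_{r\times r}(\mathbb{C}\{t,z]])$ with $T^{(0)}(0)$ invertible such that $\tilde T:=T\circ h$ satisfies $$z\partial_i\tilde T+\sum_j(\partial_ih^j)(A_j\circ h)\tilde T-\tilde T\tilde A_i=0\ \ \forall i,\qquad z^2\partial_z\tilde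 T+(B\circ h)\tilde T-\tilde T\tilde B=0 .$$ It is a formal gauge isomorphism if $h=\mathrm{id}$. $\nabla$ and $\tilde\nabla$ are formally (gauge) isomorphic if there is a formal (gauge) isomorphism between them. Let $m=r=2$, $C_1=\mathrm{Id}_2$, $C_2=\begin{pmatrix}0&0\\1&0\end{pmatrix}$, $D=\begin{pmatrix}1&0\\0&-1\end{pmatrix}$, $E=\begin{pmatrix}0&1\\0&0\end{pmatrix}$. The *formal normal forms* are the following formal $(TE)$-structures over $(\mathbb{C}^2,0)$, all with $A_1=C_1$, where $c,\alpha,c_0,\gamma\in\mathbb{C}$ and $\beta:=-t_1+c+\alpha z$: (i) $A_2=C_2+zE$, $\ B=\beta C_1+(-\tfrac{t_2}{2}+c_0)C_2-\tfrac z4D+z(-\tfrac{t_2}{2}+c_0)E$; (ii) for $r\in\mathbb{Z}_{\ge1}$: $A_2=C_2+zt_2^rE$, $\ B=\beta C_1-\tfrac{t_2}{r+2}C_2-\tfrac{z(r+1)}{2(r+2)}D-\tfrac{zt_2^{r+1}}{r+2}E$; (iii) $A_2=C_2$ and $B$ one of 1. $\beta C_1-\tfrac z2D$; 2. $\beta C_1+t_2^2C_2-z(t_2+\tfrac12)D-z^2E$;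 3. $\beta C_1+\lambda t_2C_2-\tfrac z2(\lambda+1)D$, with $\lambda\in\mathbb{C}$, $\lambda\notin\mathbb{Z}\setminus\{0\}$; 4. $\beta C_1+(\lambda t_2+1)C_2-\tfrac z2(\lambda+1)D$, with $\lambda\in\mathbb{C}$, $\lambda\notin\mathbb{Z}\setminus\{0\}$; 5. $\beta C_1+(\lambda t_2+1+\gamma t_2^2z^\lambda)C_2-\tfrac z2(\lambda+1+2\gamma t_2z^\lambda)D-\gamma z^{\lambda+2}E$, with $\lambda\in\mathbb{Z}_{\ge1}$; 6. $\beta C_1+t_2(\lambda+t_2z^\lambda)C_2-\tfrac z2(\lambda+1+2t_2z^\lambda)D-z^{\lambda+2}E$, with $\lambda\in\mathbb{Z}_{\ge1}$; 7. $\beta C_1+\lambda t_2C_2-\tfrac z2(\lambda+1)D$, with $\lambda\in\mathbb{Z}_{\ge1}$; 8. $\beta C_1+(\lambda t_2+z^{-\lambda})C_2-\tfrac z2(\lambda+1)D$, with $\lambda\in\mathbb{Z}_{\le-1}$; 9. $\beta C_1+\lambda t_2C_2-\tfrac z2(\lambda+1)D$, with $\lambda\in\mathbb{Z}_{\le-1}$.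 **Theorem.** Any two distinct $(TE)$-structures $\nabla$, $\tilde\nabla$ in formal normal form are formally non-isomorphic, except when: (a) both are of the form (i), with constants $c,\alpha,c_0$ and $\tilde c,\tilde\alpha,\tilde c_0$, and $c_0\tilde c_0\ne0$. Then (being distinct) they are formally isomorphic if and only if $\tilde c=c$, $\tilde\alpha=\alpha$ and $\tilde c_0=-c_0$, and they are not formally gauge isomorphic; (b) both are of the form (iii.4), with constants $c,\alpha,\lambda$ and $\tilde c,\tilde\alpha,\tilde\lambda$, and $\lambda\tilde\lambda\neq0$. Then (being distinct) they are formally isomorphic if and only if $\tilde c=c$, $\tilde\alpha=\alpha$ and $\tilde\lambda=-\lambda$, and they are not formally gauge isomorphic. -/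

import Mathlib

open scoped Topology

noncomputable section

namespace TEStruct

/-- Formal power series in `z` whose coefficients are functions of `t = (t₁, …, t_m)`. -/
abbrev FSeries (m : ℕ) : Type := PowerSeries ((Fin m → ℂ) → ℂ)

/-- Square matrices of size `r` with entries in `FSeries m`. -/
abbrev FMat (m r : ℕ) : Type := Matrix (Fin r) (Fin r) (FSeries m)

/-- The matrix has entries in `ℂ{t, z]]`: all coefficients of all entries are holomorphic
on the same neighbourhood of the origin. -/
def IsHol {m r : ℕ} (F : FMat m r) : Prop :=
  ∃ U ∈ 𝓝 (0 : Fin m → ℂ), ∀ a b n, AnalyticOnNhd ℂ (PowerSeries.coeff n (F a b)) U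

/-- Equality over the germ `(ℂ^m, 0)`: all coefficients agree as germs at the origin. -/
def GermEq {m r : ℕ} (F G : FMat m r) : Prop :=
  ∀ a b n, PowerSeries.coeff n (F a b) =ᶠ[𝓝 (0 : Fin m → ℂ)] PowerSeries.coeff n (G a b)

/-- The partial derivative `∂_i f` of a function of `t`. -/
def pdFun {m : ℕ} (i : Fin m) (f : (Fin m → ℂ) → ℂ) : (Fin m → ℂ) → ℂ :=
  fun t => fderiv ℂ f t (Pi.single i 1)

/-- `∂_i` on power series in `z`, coefficient by coefficient. -/
def pdSeries {m : ℕ} (i : Fin m) (f : FSeries m) : FSeries m :=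
  PowerSeries.mk fun n => pdFun i (PowerSeries.coeff n f)

/-- `∂_i` on matrices, entry by entry. -/
def pd {m r : ℕ} (i : Fin m) (F : FMat m r) : FMat m r := F.map (pdSeries i)

/-- `∂_z` on matrices, entry by entry. -/
def dz {m r : ℕ} (F : FMat m r) : FMat m r := F.map fun f => PowerSeries.derivative _ f

/-- `F ∘ h`, where `h` acts on the variable `t` only. -/
def pullback {m r : ℕ} (F : FMat m r) (h : (Fin m → ℂ) → (Fin m → ℂ)) : FMat m r :=
  F.map fun f => PowerSeries.mk fun n => PowerSeries.coeff n f ∘ h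

/-- The variable `z`. -/
def zz (m : ℕ) : FSeries m := PowerSeries.X

/-- The coordinate function `t_i` (numbered from `0`). -/
def tt {m : ℕ} (i : Fin m) : FSeries m := PowerSeries.C fun t => t i

/-- Complex constants. -/
def kk {m : ℕ} (c : ℂ) : FSeries m := PowerSeries.C fun _ => c

/-- A formal `(TE)`-structure of rank `r` over `(ℂ^m, 0)`, on the trivial bundle, given by the
connection form `∑ z⁻¹ A_i dt_i + z⁻² B dz` with `A_i`, `B` matrices over `ℂ{t, z]]`,
which is flat. -/
structure FormalTE (m r : ℕ) where
  A : Fin m → FMat m r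
  B : FMat m r
  hol_A : ∀ i, IsHol (A i)
  hol_B : IsHol B
  flat_A : ∀ i j, GermEq
    (zz m • pd i (A j) - zz m • pd j (A i) + (A i * A j - A j * A i)) 0
  flat_B : ∀ i, GermEq
    (zz m • pd i B - zz m ^ 2 • dz (A i) + zz m • A i + (A i * B - B * A i)) 0

/-- Two formal `(TE)`-structures over `(ℂ^m, 0)` are the same: their connection forms agree as
germs. -/
def FormalTE.Same {m r : ℕ} (N N' : FormalTE m r) : Prop :=
  (∀ i, GermEq (N.A i) (N'.A i)) ∧ GermEq N.B N'.B

/-- `h` is (a representative of) a biholomorphic map germ `(ℂ^m, 0) → (ℂ^m, 0)`. -/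
def IsBiholGerm {m : ℕ} (h : (Fin m → ℂ) → (Fin m → ℂ)) : Prop :=
  AnalyticAt ℂ h 0 ∧ h 0 = 0 ∧
    ∃ g : (Fin m → ℂ) → (Fin m → ℂ), AnalyticAt ℂ g 0 ∧ g 0 = 0 ∧
      (∀ᶠ t in 𝓝 0, g (h t) = t) ∧ (∀ᶠ t in 𝓝 0, h (g t) = t)

/-- `T = ∑ T⁽ⁿ⁾ zⁿ` is a formal isomorphism between `N` (with matrices `A_i`, `B`) and `N'`
(with matrices `Ã_i`, `B̃`) which covers `h`. With `T̃ = T ∘ h` the equations are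
`z ∂_i T̃ + ∑_j (∂_i h^j) (A_j ∘ h) T̃ - T̃ Ã_i = 0` and
`z² ∂_z T̃ + (B ∘ h) T̃ - T̃ B̃ = 0`. -/
structure IsFormalIso {m r : ℕ} (N N' : FormalTE m r) (h : (Fin m → ℂ) → (Fin m → ℂ))
    (T : FMat m r) : Prop where
  bihol : IsBiholGerm h
  hol : IsHol T
  invertible : (Matrix.of fun a b => PowerSeries.coeff 0 (T a b) 0).det ≠ 0
  eq_t : ∀ i, GermEq
    (zz m • pd i (pullback T h)
      + ∑ j, (PowerSeries.C (pdFun i fun t => h t j) : FSeries m) •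
          (pullback (N.A j) h * pullback T h)
      - pullback T h * N'.A i) 0
  eq_z : GermEq
    (zz m ^ 2 • dz (pullback T h) + pullback N.B h * pullback T h - pullback T h * N'.B) 0

/-- `N` and `N'` are formally isomorphic. -/
def FormallyIso {m r : ℕ} (N N' : FormalTE m r) : Prop := ∃ h T, IsFormalIso N N' h T

/-- `N` and `N'` are formally gauge isomorphic: there is a formal isomorphism which covers the
identity map. -/
def FormallyGaugeIso {m r : ℕ} (N N' : FormalTE m r) : Prop := ∃ T, IsFormalIso N N' id T

/-! ### The matrices `C₁ = Id`, `C₂`, `D`, `E` -/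

def C₁ : FMat 2 2 := 1
def C₂ : FMat 2 2 := !![0, 0; 1, 0]
def D : FMat 2 2 := !![1, 0; 0, -1]
def E : FMat 2 2 := !![0, 1; 0, 0]

/-- The variables `z`, `t₁`, `t₂`. -/
def z : FSeries 2 := zz 2
def t₁ : FSeries 2 := tt 0
def t₂ : FSeries 2 := tt 1

/-- The (names of the) formal normal forms, with their constants. In `iii5`, `iii6`, `iii7` the
positive integer `n` is `λ`; in `iii8`, `iii9` the negative integer `λ` is `-n`. -/
inductive NormalForm : Type
  | i (c α c₀ : ℂ)
  | ii (c α : ℂ) (r : ℕ) (hr : 1 ≤ r)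
  | iii1 (c α : ℂ)
  | iii2 (c α : ℂ)
  | iii3 (c α l : ℂ) (hl : ¬ ∃ n : ℤ, n ≠ 0 ∧ l = n)
  | iii4 (c α l : ℂ) (hl : ¬ ∃ n : ℤ, n ≠ 0 ∧ l = n)
  | iii5 (c α γ : ℂ) (n : ℕ) (hn : 1 ≤ n)
  | iii6 (c α : ℂ) (n : ℕ) (hn : 1 ≤ n)
  | iii7 (c α : ℂ) (n : ℕ) (hn : 1 ≤ n)
  | iii8 (c α : ℂ) (n : ℕ) (hn : 1 ≤ n)
  | iii9 (c α : ℂ) (n : ℕ) (hn : 1 ≤ n)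

namespace NormalForm

/-- The matrix `A₂` of a formal normal form (the matrix `A₁` is always `C₁`). -/
def A₂ : NormalForm → FMat 2 2
  | i _ _ _ => C₂ + z • E
  | ii _ _ r _ => C₂ + (z * t₂ ^ r) • E
  | _ => C₂

/-- The matrix `B` of a formal normal form. -/
def B : NormalForm → FMat 2 2
  | i c α c₀ =>
      (-t₁ + kk c + kk α * z) • C₁ + (-(kk (1 / 2) * t₂) + kk c₀) • C₂
        - (kk (1 / 4) * z) • D + (z * (-(kk (1 / 2) * t₂) + kk c₀)) • E
  | ii c α r _ =>
      (-t₁ + kk c + kk α * z) • C₁ - (kk (1 / (r + 2)) * t₂) • C₂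
        - (kk ((r + 1) / (2 * (r + 2))) * z) • D - (kk (1 / (r + 2)) * z * t₂ ^ (r + 1)) • E
  | iii1 c α =>
      (-t₁ + kk c + kk α * z) • C₁ - (kk (1 / 2) * z) • D
  | iii2 c α =>
      (-t₁ + kk c + kk α * z) • C₁ + t₂ ^ 2 • C₂ - (z * (t₂ + kk (1 / 2))) • D - z ^ 2 • E
  | iii3 c α l _ =>
      (-t₁ + kk c + kk α * z) • C₁ + (kk l * t₂) • C₂ - (kk (1 / 2) * z * (kk l + 1)) • D
  | iii4 c α l _ =>
      (-t₁ + kk c + kk α * z) • C₁ + (kk l * t₂ + 1) • C₂ - (kk (1 / 2) * z * (kk l + 1)) • D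
  | iii5 c α γ n _ =>
      (-t₁ + kk c + kk α * z) • C₁ + (kk n * t₂ + 1 + kk γ * t₂ ^ 2 * z ^ n) • C₂
        - (kk (1 / 2) * z * (kk n + 1 + 2 * kk γ * t₂ * z ^ n)) • D
        - (kk γ * z ^ (n + 2)) • E
  | iii6 c α n _ =>
      (-t₁ + kk c + kk α * z) • C₁ + (t₂ * (kk n + t₂ * z ^ n)) • C₂
        - (kk (1 / 2) * z * (kk n + 1 + 2 * t₂ * z ^ n)) • D - z ^ (n + 2) • E
  | iii7 c α n _ =>
      (-t₁ + kk c + kk α * z) • C₁ + (t₂ * kk n) • C₂ - (kk (1 / 2) * z * (kk n + 1)) • D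
  | iii8 c α n _ =>
      (-t₁ + kk c + kk α * z) • C₁ + (kk (-n) * t₂ + z ^ n) • C₂
        - (kk (1 / 2) * z * (kk (-n) + 1)) • D
  | iii9 c α n _ =>
      (-t₁ + kk c + kk α * z) • C₁ + (kk (-n) * t₂) • C₂
        - (kk (1 / 2) * z * (kk (-n) + 1)) • D

end NormalForm

/-! ### The formal normal forms are formal `(TE)`-structures -/

/-- All coefficients are entire functions of `t`. -/
def Entire {m : ℕ} (f : FSeries m) : Prop :=
  ∀ n, AnalyticOnNhd ℂ (PowerSeries.coeff n f) Set.univ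

theorem Entire.add {m : ℕ} {f g : FSeries m} (hf : Entire f) (hg : Entire g) :
    Entire (f + g) := fun n => by
  rw [map_add]; exact (hf n).add (hg n)

theorem Entire.neg {m : ℕ} {f : FSeries m} (hf : Entire f) : Entire (-f) := fun n => by
  rw [map_neg]; exact (hf n).neg

theorem Entire.sub {m : ℕ} {f g : FSeries m} (hf : Entire f) (hg : Entire g) :
    Entire (f - g) := by
  rw [sub_eq_add_neg]; exact hf.add hg.neg

theorem Entire.mul {m : ℕ} {f g : FSeries m} (hf : Entire f) (hg : Entire g) :
    Entire (f * g) := fun n => by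
  rw [PowerSeries.coeff_mul]
  exact Finset.analyticOnNhd_sum _ fun p _ => (hf p.1).mul (hg p.2)

theorem entire_C {m : ℕ} {f : (Fin m → ℂ) → ℂ} (hf : AnalyticOnNhd ℂ f Set.univ) :
    Entire (PowerSeries.C f : FSeries m) := fun n => by
  rw [PowerSeries.coeff_C]
  split_ifs
  · exact hf
  · exact analyticOnNhd_const

theorem entire_kk {m : ℕ} (c : ℂ) : Entire (kk c : FSeries m) :=
  entire_C analyticOnNhd_const

theorem entire_zero {m : ℕ} : Entire (0 : FSeries m) := by
  intro n; rw [map_zero]; exact analyticOnNhd_const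

theorem entire_one {m : ℕ} : Entire (1 : FSeries m) := entire_kk 1

theorem entire_two {m : ℕ} : Entire (2 : FSeries m) := by
  rw [← one_add_one_eq_two]; exact entire_one.add entire_one

theorem entire_tt {m : ℕ} (i : Fin m) : Entire (tt i : FSeries m) :=
  entire_C fun x _ => (ContinuousLinearMap.proj (R := ℂ) (φ := fun _ : Fin m => ℂ) i).analyticAt x

theorem entire_zz {m : ℕ} : Entire (zz m) := fun n => by
  rw [zz, PowerSeries.coeff_X]
  split_ifs
  · exact analyticOnNhd_const
  · exact analyticOnNhd_const

theorem Entire.pow {m : ℕ} {f : FSeries m} (hf : Entire f) (n : ℕ) : Entire (f ^ n) := by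
  induction n with
  | zero => rw [pow_zero]; exact entire_one
  | succ n ih => rw [pow_succ]; exact ih.mul hf

theorem Entire.diffAt {m : ℕ} {f : FSeries m} (hf : Entire f) (n : ℕ) (t : Fin m → ℂ) :
    DifferentiableAt ℂ (PowerSeries.coeff n f) t := (hf n t trivial).differentiableAt

/-- `f` is entire in `t` and `∂_i f = f'`. -/
def HasPd {m : ℕ} (i : Fin m) (f f' : FSeries m) : Prop := Entire f ∧ pdSeries i f = f'

section HasPd

variable {m : ℕ} {i : Fin m} {f g f' g' : FSeries m}

theorem HasPd.add (hf : HasPd i f f') (hg : HasPd i g g') : HasPd i (f + g) (f' + g') := by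
  refine ⟨hf.1.add hg.1, ?_⟩
  rw [← hf.2, ← hg.2]
  ext n t
  simp only [pdSeries, PowerSeries.coeff_mk, map_add, pdFun, Pi.add_apply]
  rw [fderiv_add (hf.1.diffAt n t) (hg.1.diffAt n t)]
  rfl

theorem HasPd.neg (hf : HasPd i f f') : HasPd i (-f) (-f') := by
  refine ⟨hf.1.neg, ?_⟩
  rw [← hf.2]
  ext n t
  simp only [pdSeries, PowerSeries.coeff_mk, map_neg, pdFun, Pi.neg_apply]
  rw [fderiv_neg]
  rfl

theorem HasPd.sub (hf : HasPd i f f') (hg : HasPd i g g') : HasPd i (f - g) (f' - g') := by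
  rw [sub_eq_add_neg, sub_eq_add_neg]; exact hf.add hg.neg

theorem HasPd.mul (hf : HasPd i f f') (hg : HasPd i g g') :
    HasPd i (f * g) (f' * g + f * g') := by
  refine ⟨hf.1.mul hg.1, ?_⟩
  rw [← hf.2, ← hg.2]
  ext n t
  simp only [pdSeries, PowerSeries.coeff_mk, map_add, Pi.add_apply, PowerSeries.coeff_mul, pdFun]
  rw [fderiv_sum fun p _ => (hf.1.diffAt p.1 t).mul (hg.1.diffAt p.2 t)]
  simp only [Finset.sum_apply, sum_apply, Pi.mul_apply]
  rw [← Finset.sum_add_distrib]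
  refine Finset.sum_congr rfl fun p _ => ?_
  rw [fderiv_mul (hf.1.diffAt p.1 t) (hg.1.diffAt p.2 t)]
  simp only [add_apply, smul_apply, smul_eq_mul, pdFun]
  ring

theorem hasPd_kk (c : ℂ) : HasPd i (kk c) 0 := by
  refine ⟨entire_kk c, ?_⟩
  ext n t
  simp only [pdSeries, PowerSeries.coeff_mk, kk, PowerSeries.coeff_C, pdFun, map_zero,
    Pi.zero_apply]
  split_ifs
  · simp
  · change (fderiv ℂ (fun _ => (0 : ℂ)) t) _ = 0
    simp

theorem hasPd_zero : HasPd i (0 : FSeries m) 0 := by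
  have h := hasPd_kk (i := i) (m := m) 0
  have h0 : (kk 0 : FSeries m) = 0 := map_zero PowerSeries.C
  rwa [h0] at h

theorem hasPd_one : HasPd i (1 : FSeries m) 0 := hasPd_kk 1

theorem hasPd_two : HasPd i (2 : FSeries m) 0 := by
  have h := (hasPd_one (i := i) (m := m)).add hasPd_one
  rwa [one_add_one_eq_two, add_zero] at h

theorem hasPd_zz : HasPd i (zz m) 0 := by
  refine ⟨entire_zz, ?_⟩
  ext n t
  simp only [pdSeries, PowerSeries.coeff_mk, zz, PowerSeries.coeff_X, pdFun, map_zero,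
    Pi.zero_apply]
  split_ifs
  · change (fderiv ℂ (fun _ => (1 : ℂ)) t) _ = 0
    simp
  · change (fderiv ℂ (fun _ => (0 : ℂ)) t) _ = 0
    simp

theorem hasPd_tt (j : Fin m) : HasPd i (tt j) (kk (if j = i then 1 else 0)) := by
  refine ⟨entire_tt j, ?_⟩
  ext n t
  simp only [pdSeries, PowerSeries.coeff_mk, tt, kk, PowerSeries.coeff_C, pdFun]
  by_cases hn : n = 0
  · simp only [hn, if_true]
    have := (ContinuousLinearMap.proj (R := ℂ) (φ := fun _ : Fin m => ℂ) j).hasFDerivAt (x := t)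
    have h2 : fderiv ℂ (fun t : Fin m → ℂ => t j) t
        = ContinuousLinearMap.proj (R := ℂ) (φ := fun _ : Fin m => ℂ) j := this.fderiv
    rw [h2]
    simp [Pi.single_apply]
  · simp only [hn, if_false]
    change (fderiv ℂ (fun _ => (0 : ℂ)) t) _ = 0
    simp

theorem HasPd.pow (hf : HasPd i f f') (n : ℕ) :
    HasPd i (f ^ n) ((n : FSeries m) * f ^ (n - 1) * f') := by
  induction n with
  | zero => simpa using hasPd_one
  | succ n ih =>
    rw [pow_succ]
    have := ih.mul hf
    convert this using 1
    cases n with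
    | zero => simp
    | succ n =>
      simp only [Nat.add_sub_cancel]
      push_cast
      ring

theorem HasPd.congr (hf : HasPd i f f') (h : f' = g') : HasPd i f g' := h ▸ hf

end HasPd

theorem GermEq.of_eq {m r : ℕ} {F G : FMat m r} (h : F = G) : GermEq F G := by
  subst h
  intro a b n
  exact Filter.EventuallyEq.rfl

theorem IsHol.of_entire {m r : ℕ} {F : FMat m r} (h : ∀ a b, Entire (F a b)) : IsHol F :=
  ⟨Set.univ, Filter.univ_mem, fun a b n => h a b n⟩

/-- Formal `(TE)`-structures with `A₁ = C₁`, `A₂ = C₂ + z f E` and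
`B = (-t₁ + c + α z) C₁ + b₂ C₂ + z b₃ D + z b₄ E`. -/
theorem flat_of_eqs {f b₂ b₃ b₄ b₂' b₃' b₄' : FSeries 2} {c α : ℂ} {A B : FMat 2 2}
    (hA : A = C₂ + (z * f) • E)
    (hB : B = (-t₁ + kk c + kk α * z) • C₁ + b₂ • C₂ + (z * b₃) • D + (z * b₄) • E)
    (hf : HasPd 0 f 0) (hfz : PowerSeries.derivative _ f = 0)
    (h₂ : HasPd 0 b₂ 0) (h₃ : HasPd 0 b₃ 0) (h₄ : HasPd 0 b₄ 0)
    (h₂' : HasPd 1 b₂ b₂') (h₃' : HasPd 1 b₃ b₃') (h₄' : HasPd 1 b₄ b₄')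
    (e₁ : b₂' + 2 * b₃ + 1 = 0) (e₂ : z * b₃' - b₄ + f * b₂ = 0)
    (e₃ : b₄' - 2 * f * b₃ = 0) :
    IsHol A ∧ IsHol B ∧
    (∀ i j, GermEq (zz 2 • pd i (![C₁, A] j) - zz 2 • pd j (![C₁, A] i)
      + (![C₁, A] i * ![C₁, A] j - ![C₁, A] j * ![C₁, A] i)) 0) ∧
    (∀ i, GermEq (zz 2 • pd i B - zz 2 ^ 2 • dz (![C₁, A] i) + zz 2 • ![C₁, A] i
      + (![C₁, A] i * B - B * ![C₁, A] i)) 0) := by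
  have hk0 : (kk 0 : FSeries 2) = 0 := map_zero PowerSeries.C
  have hk1 : (kk 1 : FSeries 2) = 1 := map_one PowerSeries.C
  have hz : ∀ i, HasPd i z 0 := fun i => hasPd_zz
  have ht0 : HasPd 0 t₁ 1 := (hasPd_tt 0).congr (by simpa using hk1)
  have ht1 : HasPd 1 t₁ 0 := (hasPd_tt 0).congr (by simpa using hk0)
  have hA' : A = !![0, z * f; 1, 0] := by
    rw [hA]; refine Matrix.ext fun a b => ?_; fin_cases a <;> fin_cases b <;> simp [C₂, E]
  have hB' : B = !![-t₁ + kk c + kk α * z + z * b₃, z * b₄; b₂,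
      -t₁ + kk c + kk α * z - z * b₃] := by
    rw [hB]; refine Matrix.ext fun a b => ?_; fin_cases a <;> fin_cases b <;> simp [C₁, C₂, D, E] <;> ring
  have h1 : C₁ = !![1, 0; 0, 1] := by
    refine Matrix.ext fun a b => ?_; fin_cases a <;> fin_cases b <;> simp [C₁]
  have p0 : ∀ i : Fin 2, pd i C₁ = 0 := fun i => by
    rw [h1]
    refine Matrix.ext fun a b => ?_
    fin_cases a <;> fin_cases b
    · exact hasPd_one.2
    · exact hasPd_zero.2
    · exact hasPd_zero.2
    · exact hasPd_one.2
  have pA : pd 0 A = 0 := by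
    rw [hA']
    refine Matrix.ext fun a b => ?_
    fin_cases a <;> fin_cases b
    · exact hasPd_zero.2
    · exact (((hz 0).mul hf).congr (by ring : _ = (0 : FSeries 2))).2
    · exact hasPd_one.2
    · exact hasPd_zero.2
  have s0 : HasPd 0 (-t₁ + kk c + kk α * z) (-1) :=
    ((ht0.neg.add (hasPd_kk c)).add ((hasPd_kk α).mul (hz 0))).congr (by ring)
  have s1 : HasPd 1 (-t₁ + kk c + kk α * z) 0 :=
    ((ht1.neg.add (hasPd_kk c)).add ((hasPd_kk α).mul (hz 1))).congr (by ring)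
  have B0 : pd 0 B = !![-1, 0; 0, -1] := by
    rw [hB']
    refine Matrix.ext fun a b => ?_
    fin_cases a <;> fin_cases b
    · exact ((s0.add ((hz 0).mul h₃)).congr (by ring : _ = (-1 : FSeries 2))).2
    · exact (((hz 0).mul h₄).congr (by ring : _ = (0 : FSeries 2))).2
    · exact h₂.2
    · exact ((s0.sub ((hz 0).mul h₃)).congr (by ring : _ = (-1 : FSeries 2))).2
  have B1 : pd 1 B = !![z * b₃', z * b₄'; b₂', - (z * b₃')] := by
    rw [hB']
    refine Matrix.ext fun a b => ?_
    fin_cases a <;> fin_cases b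
    · exact ((s1.add ((hz 1).mul h₃')).congr (by ring : _ = z * b₃')).2
    · exact (((hz 1).mul h₄').congr (by ring : _ = z * b₄')).2
    · exact h₂'.2
    · exact ((s1.sub ((hz 1).mul h₃')).congr (by ring : _ = -(z * b₃'))).2
  have dz1 : dz C₁ = 0 := by
    rw [h1]; refine Matrix.ext fun a b => ?_; fin_cases a <;> fin_cases b <;> simp [dz]
  have dzA : dz A = !![0, f; 0, 0] := by
    rw [hA']; refine Matrix.ext fun a b => ?_
    fin_cases a <;> fin_cases b <;> simp [dz, z, zz, hfz, Derivation.leibniz]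
  refine ⟨?_, ?_, ?_, ?_⟩
  · rw [hA']
    refine IsHol.of_entire fun a b => ?_
    fin_cases a <;> fin_cases b
    · exact entire_zero
    · exact ((hz 0).mul hf).1
    · exact entire_one
    · exact entire_zero
  · rw [hB']
    refine IsHol.of_entire fun a b => ?_
    fin_cases a <;> fin_cases b
    · exact (s0.add ((hz 0).mul h₃)).1
    · exact ((hz 0).mul h₄).1
    · exact h₂.1
    · exact (s0.sub ((hz 0).mul h₃)).1
  · intro i j
    refine GermEq.of_eq ?_
    fin_cases i <;> fin_cases j <;> simp [p0, pA] <;> simp [C₁]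
  · intro i
    refine GermEq.of_eq ?_
    fin_cases i
    · simp only [Fin.zero_eta, Matrix.cons_val_zero, B0, dz1]
      have : B = C₁ * B := (one_mul B).symm
      rw [show C₁ * B - B * C₁ = 0 by simp [C₁], h1]
      refine Matrix.ext fun a b => ?_
      fin_cases a <;> fin_cases b <;> simp
    · simp only [Fin.mk_one, Matrix.cons_val_one, Matrix.cons_val_fin_one, B1, dzA]
      rw [hA', hB', show zz 2 = z from rfl]
      refine Matrix.ext fun a b => ?_
      fin_cases a <;> fin_cases b <;> simp
      · linear_combination z * e₂
      · linear_combination z ^ 2 * e₃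
      · linear_combination z * e₁
      · linear_combination -z * e₂

theorem kk_half : (2 : FSeries 2) * kk (1 / 2) = 1 := by
  have h2 : (2 : FSeries 2) = kk 2 := (map_ofNat PowerSeries.C 2).symm
  rw [h2, kk, kk, ← map_mul]
  refine Eq.trans (congrArg _ ?_) (map_one PowerSeries.C)
  funext t
  simp

namespace NormalForm

theorem flat (P : NormalForm) :
    IsHol P.A₂ ∧ IsHol P.B ∧
    (∀ i j, GermEq (zz 2 • pd i (![C₁, P.A₂] j) - zz 2 • pd j (![C₁, P.A₂] i)
      + (![C₁, P.A₂] i * ![C₁, P.A₂] j - ![C₁, P.A₂] j * ![C₁, P.A₂] i)) 0) ∧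
    (∀ i, GermEq (zz 2 • pd i P.B - zz 2 ^ 2 • dz (![C₁, P.A₂] i) + zz 2 • ![C₁, P.A₂] i
      + (![C₁, P.A₂] i * P.B - P.B * ![C₁, P.A₂] i)) 0) := by
  have hk0 : (kk 0 : FSeries 2) = 0 := map_zero PowerSeries.C
  have hk1 : (kk 1 : FSeries 2) = 1 := map_one PowerSeries.C
  have hz : ∀ i, HasPd i z 0 := fun i => hasPd_zz
  have h0 : HasPd 0 t₂ 0 := (hasPd_tt 1).congr (by simpa using hk0)
  have h1 : HasPd 1 t₂ 1 := (hasPd_tt 1).congr (by simpa using hk1)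
  have hh := kk_half
  -- the cases with `f = 0` and `b₂ = u + v t₂ + w t₂²`, where `u`, `v`, `w` depend on `z` only
  have key : ∀ (c α : ℂ) (A B : FMat 2 2) (u v w : FSeries 2), A = C₂ →
      (∀ i, HasPd i u 0) → (∀ i, HasPd i v 0) → (∀ i, HasPd i w 0) →
      B = (-t₁ + kk c + kk α * z) • C₁ + (u + v * t₂ + w * t₂ ^ 2) • C₂
        + (z * (-(kk (1 / 2) * (v + 1)) - w * t₂)) • D + (z * (-(z * w))) • E → _ :=
    fun c α A B u v w hA hu hv hw hB =>
      flat_of_eqs (f := 0) (A := A) (B := B) (by rw [hA]; simp) hB hasPd_zero (map_zero _)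
        ((((hu 0).add ((hv 0).mul h0)).add ((hw 0).mul (h0.pow 2))).congr (by ring))
        (((((hasPd_kk _).mul ((hv 0).add hasPd_one)).neg).sub ((hw 0).mul h0)).congr (by ring))
        ((((hz 0).mul (hw 0)).neg).congr (by ring))
        (((hu 1).add ((hv 1).mul h1)).add ((hw 1).mul (h1.pow 2)))
        ((((hasPd_kk _).mul ((hv 1).add hasPd_one)).neg).sub ((hw 1).mul h1))
        (((hz 1).mul (hw 1)).neg)
        (by simp only [Nat.cast_ofNat, Nat.add_one_sub_one, pow_one]; linear_combination -(v + 1) * hh) (by ring) (by ring)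
  have hzn : ∀ (n : ℕ) (i), HasPd i (z ^ n) 0 := fun n i => ((hz i).pow n).congr (by ring)
  cases P with
  | i c α c₀ =>
    have hq : (2 : FSeries 2) * kk (1 / 4) = kk (1 / 2) := by
      have h2 : (2 : FSeries 2) = kk 2 := (map_ofNat PowerSeries.C 2).symm
      rw [h2, kk, kk, kk, ← map_mul]
      refine congrArg _ ?_
      funext t
      simp; norm_num
    refine flat_of_eqs (f := 1) (b₂ := -(kk (1 / 2) * t₂) + kk c₀) (b₃ := -kk (1 / 4))
      (b₄ := -(kk (1 / 2) * t₂) + kk c₀) (c := c) (α := α)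
      (by simp [A₂]) ?_ hasPd_one (by simp)
      (((((hasPd_kk _).mul h0).neg).add (hasPd_kk _)).congr (by ring))
      ((hasPd_kk _).neg.congr (by ring))
      (((((hasPd_kk _).mul h0).neg).add (hasPd_kk _)).congr (by ring))
      ((((hasPd_kk _).mul h1).neg).add (hasPd_kk _))
      (hasPd_kk _).neg
      ((((hasPd_kk _).mul h1).neg).add (hasPd_kk _)) ?_ ?_ ?_
    · simp only [B]
      refine Matrix.ext fun a b => ?_
      fin_cases a <;> fin_cases b <;> simp [C₁, C₂, D, E] <;> ring
    · linear_combination -hq - hh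
    · ring
    · linear_combination hq
  | ii c α r hr =>
    have hq : (2 : FSeries 2) * kk ((r + 1) / (2 * (r + 2))) + kk (1 / (r + 2)) = 1 := by
      have h2 : (2 : FSeries 2) = kk 2 := (map_ofNat PowerSeries.C 2).symm
      rw [h2, kk, kk, kk, ← map_mul, ← map_add]
      refine Eq.trans (congrArg _ ?_) (map_one PowerSeries.C)
      funext t
      have : (r : ℂ) + 2 ≠ 0 := by exact_mod_cast (by omega : r + 2 ≠ 0)
      simp
      field_simp
      ring
    have hq2 : ((r : FSeries 2) + 1) * kk (1 / (r + 2)) = 2 * kk ((r + 1) / (2 * (r + 2))) := by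
      have h2 : (2 : FSeries 2) = kk 2 := (map_ofNat PowerSeries.C 2).symm
      have hr' : (r : FSeries 2) = kk r := (map_natCast PowerSeries.C r).symm
      rw [h2, hr', ← hk1, kk, kk, kk, kk, kk, ← map_mul, ← map_add, ← map_mul]
      refine congrArg _ ?_
      funext t
      have : (r : ℂ) + 2 ≠ 0 := by exact_mod_cast (by omega : r + 2 ≠ 0)
      simp
      field_simp
    refine flat_of_eqs (f := t₂ ^ r) (b₂ := -(kk (1 / (r + 2)) * t₂))
      (b₃ := -kk ((r + 1) / (2 * (r + 2))))
      (b₄ := -(kk (1 / (r + 2)) * t₂ ^ (r + 1))) (c := c) (α := α)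
      (by simp [A₂]) ?_ ((h0.pow r).congr (by ring)) ?_
      ((((hasPd_kk _).mul h0).neg).congr (by ring))
      ((hasPd_kk _).neg.congr (by ring))
      ((((hasPd_kk _).mul (h0.pow _)).neg).congr (by ring))
      (((hasPd_kk _).mul h1).neg)
      (hasPd_kk _).neg
      (((hasPd_kk _).mul (h1.pow _)).neg) ?_ ?_ ?_
    · simp only [B]
      refine Matrix.ext fun a b => ?_
      fin_cases a <;> fin_cases b <;> simp [C₁, C₂, D, E] <;> ring
    · simp [t₂, tt, Derivation.leibniz_pow]
    · linear_combination -hq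
    · ring
    · simp only [Nat.add_sub_cancel]
      push_cast
      linear_combination -t₂ ^ r * hq2
  | iii1 c α =>
    refine key c α _ _ 0 0 0 rfl (fun _ => hasPd_zero) (fun _ => hasPd_zero)
      (fun _ => hasPd_zero) ?_
    simp only [B]
    refine Matrix.ext fun a b => ?_
    fin_cases a <;> fin_cases b <;> simp [C₁, C₂, D, E] <;> ring
  | iii2 c α =>
    refine key c α _ _ 0 0 1 rfl (fun _ => hasPd_zero) (fun _ => hasPd_zero)
      (fun _ => hasPd_one) ?_
    simp only [B]
    refine Matrix.ext fun a b => ?_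
    fin_cases a <;> fin_cases b <;> simp [C₁, C₂, D, E] <;> ring
  | iii3 c α l hl =>
    refine key c α _ _ 0 (kk l) 0 rfl (fun _ => hasPd_zero) (fun _ => hasPd_kk _)
      (fun _ => hasPd_zero) ?_
    simp only [B]
    refine Matrix.ext fun a b => ?_
    fin_cases a <;> fin_cases b <;> simp [C₁, C₂, D, E] <;> ring
  | iii4 c α l hl =>
    refine key c α _ _ 1 (kk l) 0 rfl (fun _ => hasPd_one) (fun _ => hasPd_kk _)
      (fun _ => hasPd_zero) ?_
    simp only [B]
    refine Matrix.ext fun a b => ?_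
    fin_cases a <;> fin_cases b <;> simp [C₁, C₂, D, E] <;> ring
  | iii5 c α γ n hn =>
    refine key c α _ _ 1 (kk n) (kk γ * z ^ n) rfl (fun _ => hasPd_one) (fun _ => hasPd_kk _)
      (fun i => ((hasPd_kk _).mul (hzn n i)).congr (by ring)) ?_
    simp only [B]
    rw [show kk (1 / 2) * z * (kk n + 1 + 2 * kk γ * t₂ * z ^ n) =
      kk (1 / 2) * z * (kk n + 1) + z * kk γ * t₂ * z ^ n by
        linear_combination z * kk γ * t₂ * z ^ n * hh]
    refine Matrix.ext fun a b => ?_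
    fin_cases a <;> fin_cases b <;> simp [C₁, C₂, D, E] <;> ring
  | iii6 c α n hn =>
    refine key c α _ _ 0 (kk n) (z ^ n) rfl (fun _ => hasPd_zero) (fun _ => hasPd_kk _)
      (fun i => hzn n i) ?_
    simp only [B]
    rw [show kk (1 / 2) * z * (kk n + 1 + 2 * t₂ * z ^ n) =
      kk (1 / 2) * z * (kk n + 1) + z * t₂ * z ^ n by
        linear_combination z * t₂ * z ^ n * hh]
    refine Matrix.ext fun a b => ?_
    fin_cases a <;> fin_cases b <;> simp [C₁, C₂, D, E] <;> ring
  | iii7 c α n hn =>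
    refine key c α _ _ 0 (kk n) 0 rfl (fun _ => hasPd_zero) (fun _ => hasPd_kk _)
      (fun _ => hasPd_zero) ?_
    simp only [B]
    refine Matrix.ext fun a b => ?_
    fin_cases a <;> fin_cases b <;> simp [C₁, C₂, D, E] <;> ring
  | iii8 c α n hn =>
    refine key c α _ _ (z ^ n) (kk (-n)) 0 rfl (fun i => hzn n i) (fun _ => hasPd_kk _)
      (fun _ => hasPd_zero) ?_
    simp only [B]
    refine Matrix.ext fun a b => ?_
    fin_cases a <;> fin_cases b <;> simp [C₁, C₂, D, E] <;> ring
  | iii9 c α n hn =>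
    refine key c α _ _ 0 (kk (-n)) 0 rfl (fun _ => hasPd_zero) (fun _ => hasPd_kk _)
      (fun _ => hasPd_zero) ?_
    simp only [B]
    refine Matrix.ext fun a b => ?_
    fin_cases a <;> fin_cases b <;> simp [C₁, C₂, D, E] <;> ring

/-- The formal `(TE)`-structure, of rank `2` over `(ℂ², 0)`, given by a formal normal form. -/
def toTE (P : NormalForm) : FormalTE 2 2 where
  A := ![C₁, P.A₂]
  B := P.B
  hol_A i := by
    fin_cases i
    · refine IsHol.of_entire fun a b => ?_
      change Entire ((1 : FMat 2 2) a b)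
      rw [Matrix.one_apply]
      split_ifs
      · exact entire_one
      · exact entire_zero
    · exact P.flat.1
  hol_B := P.flat.2.1
  flat_A := P.flat.2.2.1
  flat_B := P.flat.2.2.2

end NormalForm

end TEStruct

end

/-!
Near `t = 0`, the `t`-equations force `∂₂h¹ = 0`, make the leading term `T⁽⁰⁾` lower triangular
with diagonal `(a, μ a)`, where `μ = ∂₂h²`, and relate the coefficients `f` of `z E` in `A₂` by
`μ² (f ∘ h) = f̃`, which separates (i), (ii) and (iii). The leading term of the `z`-equation shows
that the coefficient of `C₂` in `B⁽⁰⁾` is multiplied by `μ`. At `t = 0` the `z`-equation is an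
equivalence of ordinary formal connections in `z`: its trace gives `c` and `α`, its diagonal
constrains `λ`, and the exceptional powers of `z` in `B` sit exactly at the resonances `λ ∈ ℤ`,
where the off-diagonal equations determine their coefficients up to the factor `μ`. The remaining
coincidences `c₀ ↦ -c₀` and `λ ↦ -λ` are realised over `t₂ ↦ -t₂` and `t₂ ↦ t₂ / (1 - λ t₂)`. A
gauge isomorphism has `μ = 1` near `0`, so it preserves the coefficient of `C₂` in `B⁽⁰⁾`, which
excludes both coincidences.
-/

noncomputable section

namespace TEStruct

open PowerSeries

section Evaluation

variable {m r : ℕ}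

/-- The power series in `z` obtained by evaluating the coefficients at `t`. -/
def ev (t : Fin m → ℂ) : FSeries m →+* ℂ⟦X⟧ := PowerSeries.map (Pi.evalRingHom (fun _ => ℂ) t)

/-- Entrywise evaluation of a matrix at `t`. -/
def evM (t : Fin m → ℂ) : FMat m r →+* Matrix (Fin r) (Fin r) ℂ⟦X⟧ := (ev t).mapMatrix

/-- The leading term `F⁽⁰⁾(t)` of `F = ∑ F⁽ⁿ⁾ zⁿ`. -/
def lead (t : Fin m → ℂ) : FMat m r →+* Matrix (Fin r) (Fin r) ℂ :=
  ((constantCoeff (R := ℂ)).comp (ev t)).mapMatrix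

@[simp]
theorem coeff_ev (t : Fin m → ℂ) (n : ℕ) (f : FSeries m) : coeff n (ev t f) = coeff n f t := rfl

@[simp]
theorem ev_C (t : Fin m → ℂ) (f : (Fin m → ℂ) → ℂ) : ev t (C f) = C (f t) := PowerSeries.map_C _ _

@[simp]
theorem ev_kk (t : Fin m → ℂ) (c : ℂ) : ev t (kk c) = C c := ev_C t _

@[simp]
theorem ev_tt (t : Fin m → ℂ) (i : Fin m) : ev t (tt i) = C (t i) := ev_C t _

@[simp]
theorem ev_zz (t : Fin m → ℂ) : ev t (zz m) = X := PowerSeries.map_X _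

@[simp]
theorem evM_apply (t : Fin m → ℂ) (F : FMat m r) (a b : Fin r) : evM t F a b = ev t (F a b) := rfl

theorem lead_apply (t : Fin m → ℂ) (F : FMat m r) (a b : Fin r) :
    lead t F a b = coeff 0 (evM t F a b) := by
  rw [coeff_zero_eq_constantCoeff_apply]
  rfl

theorem lead_eq (t : Fin m → ℂ) (F : FMat m r) :
    lead t F = Matrix.of fun a b => coeff 0 (F a b) t := Matrix.ext (lead_apply t F)

theorem evM_smul (t : Fin m → ℂ) (f : FSeries m) (F : FMat m r) :
    evM t (f • F) = ev t f • evM t F := by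
  ext1 a b
  exact map_mul (ev t) f (F a b)

theorem evM_pullback (t : Fin m → ℂ) (F : FMat m r) (h : (Fin m → ℂ) → Fin m → ℂ) :
    evM t (pullback F h) = evM (h t) F := by
  ext a b n
  simp [pullback]

theorem evM_dz (t : Fin m → ℂ) (F : FMat m r) : evM t (dz F) = (evM t F).map (derivative ℂ) := by
  ext a b n
  simp [dz, coeff_derivative]

theorem lead_smul (t : Fin m → ℂ) (f : FSeries m) (F : FMat m r) :
    lead t (f • F) = constantCoeff (ev t f) • lead t F := by
  ext1 a b
  exact map_mul ((constantCoeff (R := ℂ)).comp (ev t)) f (F a b)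

theorem lead_pullback (t : Fin m → ℂ) (F : FMat m r) (h : (Fin m → ℂ) → Fin m → ℂ) :
    lead t (pullback F h) = lead (h t) F := by
  ext1 a b
  rw [lead_apply, lead_apply, evM_pullback]

theorem GermEq.evM_zero {F G : FMat m r} (hFG : GermEq F G) : evM 0 F = evM 0 G := by
  ext a b n
  exact (hFG a b n).self_of_nhds

theorem GermEq.eventually_lead {F G : FMat m r} (hFG : GermEq F G) :
    ∀ᶠ t in 𝓝 0, lead t F = lead t G := by
  filter_upwards [Filter.eventually_all.2 fun a => Filter.eventually_all.2 fun b => hFG a b 0]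
    with t ht
  rw [lead_eq, lead_eq]
  exact Matrix.ext ht

theorem GermEq.of_eventually_evM {F G : FMat m r} (hFG : ∀ᶠ t in 𝓝 0, evM t F = evM t G) :
    GermEq F G := by
  intro a b n
  filter_upwards [hFG] with t ht
  exact congrArg (coeff n) (congrFun (congrFun ht a) b)

end Evaluation

section FormalIso

variable {m r : ℕ} {N N' : FormalTE m r} {h : (Fin m → ℂ) → Fin m → ℂ} {T : FMat m r}

theorem IsBiholGerm.tendsto (hh : IsBiholGerm h) : Filter.Tendsto h (𝓝 0) (𝓝 0) := by
  simpa only [ContinuousAt, hh.2.1] using hh.1.continuousAt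

namespace IsFormalIso

theorem eventually_lead_t (H : IsFormalIso N N' h T) (i : Fin m) :
    ∀ᶠ t in 𝓝 0, ∑ j, pdFun i (fun s => h s j) t • (lead (h t) (N.A j) * lead (h t) T)
      = lead (h t) T * lead t (N'.A i) := by
  filter_upwards [(H.eq_t i).eventually_lead] with t ht
  simpa only [map_add, map_sub, map_sum, map_mul, map_zero, lead_smul, lead_pullback, ev_zz,
    ev_C, constantCoeff_X, constantCoeff_C, zero_smul, zero_add, sub_eq_zero] using ht

theorem eventually_lead_z (H : IsFormalIso N N' h T) :
    ∀ᶠ t in 𝓝 0, lead (h t) N.B * lead (h t) T = lead (h t) T * lead t N'.B := by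
  filter_upwards [H.eq_z.eventually_lead] with t ht
  simpa only [map_add, map_sub, map_mul, map_zero, map_pow, lead_smul, lead_pullback, ev_zz,
    constantCoeff_X, ne_eq, OfNat.ofNat_ne_zero, not_false_eq_true, zero_pow, zero_smul,
    zero_add, sub_eq_zero] using ht

theorem origin_z (H : IsFormalIso N N' h T) :
    (X ^ 2 : ℂ⟦X⟧) • (evM 0 T).map (derivative ℂ) + evM 0 N.B * evM 0 T
      = evM 0 T * evM 0 N'.B := by
  simpa only [map_add, map_sub, map_mul, map_zero, map_pow, evM_smul, evM_pullback, evM_dz,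
    ev_zz, H.bihol.2.1, sub_eq_zero] using H.eq_z.evM_zero

theorem lead_zero_det_ne_zero (H : IsFormalIso N N' h T) : (lead 0 T).det ≠ 0 := by
  rw [lead_eq]
  exact H.invertible

theorem eventually_lead_det_ne_zero (H : IsFormalIso N N' h T) :
    ∀ᶠ t in 𝓝 0, (lead (h t) T).det ≠ 0 := by
  obtain ⟨U, hU, hT⟩ := H.hol
  have hcont : ContinuousAt (fun t => (lead t T).det) 0 :=
    (continuous_id.matrix_det.continuousAt).comp (f := fun t => lead t T) <|
      continuousAt_pi.2 fun a => continuousAt_pi.2 fun b => by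
        simp only [lead_apply]
        exact (hT a b 0 0 (mem_of_mem_nhds hU)).continuousAt
  exact H.bihol.tendsto.eventually (hcont.eventually_ne H.lead_zero_det_ne_zero)

theorem of_eventually (hh : IsBiholGerm h) (hT : IsHol T) (hdet : (lead 0 T).det ≠ 0)
    (ht : ∀ i, ∀ᶠ t in 𝓝 0, (X : ℂ⟦X⟧) • evM t (pd i (pullback T h))
      + ∑ j, (C (pdFun i (fun s => h s j) t) : ℂ⟦X⟧) • (evM (h t) (N.A j) * evM (h t) T)
      = evM (h t) T * evM t (N'.A i))
    (hz : ∀ᶠ t in 𝓝 0, (X ^ 2 : ℂ⟦X⟧) • (evM (h t) T).map (derivative ℂ)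
      + evM (h t) N.B * evM (h t) T = evM (h t) T * evM t N'.B) :
    IsFormalIso N N' h T where
  bihol := hh
  hol := hT
  invertible := by rwa [← lead_eq]
  eq_t i := .of_eventually_evM <| by
    filter_upwards [ht i] with t ht
    simpa only [map_add, map_sub, map_sum, map_mul, map_zero, evM_smul, evM_pullback, ev_zz,
      ev_C, sub_eq_zero] using ht
  eq_z := .of_eventually_evM <| by
    filter_upwards [hz] with t ht
    simpa only [map_add, map_sub, map_mul, map_zero, map_pow, evM_smul, evM_pullback, evM_dz,
      ev_zz, sub_eq_zero] using ht

end IsFormalIso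

end FormalIso

section LeadTriangular

variable {K : Type*} [Field K] {p μ : K} {S : Matrix (Fin 2) (Fin 2) K}

/-- `S = !![a, 0; c, μ * a]` with `a` and `μ` nonzero: the shape of the leading term of a formal
isomorphism between structures with `A₁ = C₁` and `A₂ ≡ C₂ mod z`. -/
structure IsLeadTriangular (μ : K) (S : Matrix (Fin 2) (Fin 2) K) : Prop where
  upper : S 0 1 = 0
  diag : S 1 1 = μ * S 0 0
  corner : S 0 0 ≠ 0
  ratio : μ ≠ 0

theorem eq_zero_and_isLeadTriangular (hdet : S.det ≠ 0)
    (hS : p • S + μ • (!![0, 0; 1, 0] * S) = S * !![0, 0; 1, 0]) :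
    p = 0 ∧ IsLeadTriangular μ S := by
  have entry (i j) := congrFun₂ hS i j
  simp only [Matrix.add_apply, Matrix.smul_apply, smul_eq_mul, Matrix.mul_apply] at entry
  have e₀₀ : p * S 0 0 = S 0 1 := by simpa using entry 0 0
  have e₀₁ : p * S 0 1 = 0 := by simpa using entry 0 1
  have e₁₀ : p * S 1 0 + μ * S 0 0 = S 1 1 := by simpa using entry 1 0
  rw [Matrix.det_fin_two] at hdet
  have hp : p = 0 := by
    by_contra hp
    have hb : S 0 1 = 0 := (mul_eq_zero.1 e₀₁).resolve_left hp
    have ha : S 0 0 = 0 := (mul_eq_zero.1 (e₀₀.trans hb)).resolve_left hp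
    exact hdet (by rw [ha, hb]; ring)
  have hb : S 0 1 = 0 := by rw [← e₀₀, hp, zero_mul]
  have hd : S 1 1 = μ * S 0 0 := by rw [← e₁₀, hp, zero_mul, zero_add]
  rw [hb, hd] at hdet
  exact ⟨hp, hb, hd, fun ha => hdet (by rw [ha]; ring), fun hμ => hdet (by rw [hμ]; ring)⟩

theorem IsLeadTriangular.lower_eq {β β' w w' : K} (h : IsLeadTriangular μ S)
    (hS : !![β, 0; w, β] * S = S * !![β', 0; w', β']) : w = μ * w' := by
  have hβ : β = β' := by
    have e₀₀ : β * S 0 0 = S 0 0 * β' := by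
      simpa [Matrix.mul_apply, Matrix.vecMul, dotProduct, h.upper] using congrFun₂ hS 0 0
    exact mul_left_cancel₀ h.corner (by rw [mul_comm, e₀₀])
  have e₁₀ : w * S 0 0 + β * S 1 0 = S 1 0 * β' + S 1 1 * w' := by
    simpa [Matrix.mul_apply, Matrix.vecMul, dotProduct] using congrFun₂ hS 1 0
  refine mul_right_cancel₀ h.corner ?_
  linear_combination e₁₀ - S 1 0 * hβ + w' * h.diag

end LeadTriangular

/-- The matrices `A₁ = C₁` and `A₂ = C₂ + z f E`. -/
def formA (f : (Fin 2 → ℂ) → ℂ) : Fin 2 → FMat 2 2 := ![C₁, C₂ + (z * C f) • E]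

/-- The derivative `∂₂h²` of `h` along the `t₂`-axis. -/
def fibreDeriv (h : (Fin 2 → ℂ) → Fin 2 → ℂ) : (Fin 2 → ℂ) → ℂ := pdFun 1 fun s => h s 1

theorem evM_formA (f : (Fin 2 → ℂ) → ℂ) (t : Fin 2 → ℂ) (i : Fin 2) :
    evM t (formA f i) = ![1, !![0, X * C (f t); 1, 0]] i := by
  ext1 a b
  fin_cases i <;> fin_cases a <;> fin_cases b <;> simp [formA, C₁, C₂, E, z]

theorem lead_formA (f : (Fin 2 → ℂ) → ℂ) (t : Fin 2 → ℂ) (i : Fin 2) :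
    lead t (formA f i) = ![1, !![0, 0; 1, 0]] i := by
  ext1 a b
  rw [lead_apply, evM_formA]
  fin_cases i <;> fin_cases a <;> fin_cases b <;> simp

section RankTwo

variable {N N' : FormalTE 2 2} {h : (Fin 2 → ℂ) → Fin 2 → ℂ} {T : FMat 2 2}
  {f f' : (Fin 2 → ℂ) → ℂ}

namespace IsFormalIso

theorem eventually_lead_triangular (H : IsFormalIso N N' h T) (hN : N.A = formA f)
    (hN' : N'.A = formA f') :
    ∀ᶠ t in 𝓝 0, pdFun 1 (fun s => h s 0) t = 0 ∧
      IsLeadTriangular (fibreDeriv h t) (lead (h t) T) := by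
  filter_upwards [H.eventually_lead_det_ne_zero, H.eventually_lead_t 1] with t hdet ht
  refine eq_zero_and_isLeadTriangular hdet ?_
  simpa [hN, hN', lead_formA, fibreDeriv] using ht

theorem eventually_pd_upper_eq_zero (H : IsFormalIso N N' h T) (hN : N.A = formA f)
    (hN' : N'.A = formA f') :
    ∀ᶠ t in 𝓝 0, constantCoeff (evM t (pd 1 (pullback T h)) 0 1) = 0 := by
  have hb : ∀ᶠ t in 𝓝 0, coeff 0 (pullback T h 0 1) t = 0 := by
    filter_upwards [H.eventually_lead_triangular hN hN'] with t ht
    have hupper := ht.2.upper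
    rwa [lead_apply, ← evM_pullback] at hupper
  filter_upwards [hb.eventually_nhds] with t ht
  have hconst : coeff 0 (pullback T h 0 1) =ᶠ[𝓝 t] fun _ => 0 := ht
  rw [← coeff_zero_eq_constantCoeff_apply, evM_apply, coeff_ev, pd, Matrix.map_apply, pdSeries,
    coeff_mk, pdFun, hconst.fderiv_eq]
  simp

theorem eventually_fibreDeriv_sq_mul (H : IsFormalIso N N' h T) (hN : N.A = formA f)
    (hN' : N'.A = formA f') : ∀ᶠ t in 𝓝 0, fibreDeriv h t ^ 2 * f (h t) = f' t := by
  filter_upwards [H.eventually_lead_triangular hN hN', H.eventually_pd_upper_eq_zero hN hN',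
    H.eq_t 1 0 1 1] with t ⟨hp, hS⟩ hpd ht
  have hcoeff : fibreDeriv h t * (f (h t) * lead (h t) T 1 1) = lead (h t) T 0 0 * f' t := by
    rw [← coeff_ev, ← evM_apply] at ht
    simp only [map_add, map_sub, map_mul, evM_smul, evM_pullback, Fin.sum_univ_two, hN, hN',
      evM_formA, ev_C, ev_zz, hp] at ht
    simpa [-evM_apply, Matrix.mul_apply, Matrix.vecMul, dotProduct, mul_assoc,
      mul_left_comm (evM (h t) T 0 0) X, hpd, sub_eq_zero, lead_apply,
      fibreDeriv] using ht
  refine mul_left_cancel₀ hS.corner ?_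
  linear_combination hcoeff - fibreDeriv h t * f (h t) * hS.diag

theorem eventually_eq_zero_iff (H : IsFormalIso N N' h T) (hN : N.A = formA f)
    (hN' : N'.A = formA f') : (∀ᶠ t in 𝓝 0, f t = 0) ↔ ∀ᶠ t in 𝓝 0, f' t = 0 := by
  have hff' := H.eventually_fibreDeriv_sq_mul hN hN'
  constructor
  · intro hf
    filter_upwards [hff', H.bihol.tendsto.eventually hf] with t ht hft
    rw [← ht, hft, mul_zero]
  · intro hf'
    obtain ⟨-, -, g, hg, hg₀, -, hhg⟩ := H.bihol
    have hfh : ∀ᶠ t in 𝓝 0, f (h t) = 0 := by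
      filter_upwards [hff', hf', H.eventually_lead_triangular hN hN'] with t ht hft hS
      exact (mul_eq_zero.1 (ht.trans hft)).resolve_left (pow_ne_zero 2 hS.2.ratio)
    have hg' : Filter.Tendsto g (𝓝 0) (𝓝 0) := by
      simpa only [ContinuousAt, hg₀] using hg.continuousAt
    filter_upwards [hg'.eventually hfh, hhg] with t hft ht
    rwa [ht] at hft

theorem eventually_lower_eq (H : IsFormalIso N N' h T) (hN : N.A = formA f)
    (hN' : N'.A = formA f') {β β' w w' : (Fin 2 → ℂ) → ℂ}
    (hB : ∀ t, lead t N.B = !![β t, 0; w t, β t])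
    (hB' : ∀ t, lead t N'.B = !![β' t, 0; w' t, β' t]) :
    ∀ᶠ t in 𝓝 0, w (h t) = fibreDeriv h t * w' t := by
  filter_upwards [H.eventually_lead_triangular hN hN', H.eventually_lead_z] with t hS ht
  exact hS.2.lower_eq (by simpa only [hB, hB'] using ht)

end IsFormalIso

end RankTwo

section PowerSeriesGauge

variable {R : Type*} [CommRing R]

theorem coeff_X_mul_derivative (n : ℕ) (f : R⟦X⟧) :
    coeff n (X * derivative R f) = n * coeff n f := by
  cases n with
  | zero => simp
  | succ n =>
    rw [coeff_succ_X_mul, coeff_derivative]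
    push_cast
    ring

theorem X_sq_dvd_trace_sub_of_gauge {T B B' : Matrix (Fin 2) (Fin 2) R⟦X⟧}
    (hT : IsUnit (constantCoeff T.det))
    (hTB : (X ^ 2 : R⟦X⟧) • T.map (derivative R) + B * T = T * B') :
    X ^ 2 ∣ B'.trace - B.trace := by
  have entry (i j) : X ^ 2 * derivative R (T i j) + (B i 0 * T 0 j + B i 1 * T 1 j)
      = T i 0 * B' 0 j + T i 1 * B' 1 j := by
    simpa [Matrix.mul_apply] using congrFun₂ hTB i j
  have hdet : X ^ 2 * derivative R T.det = (B'.trace - B.trace) * T.det := by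
    rw [Matrix.det_fin_two, Matrix.trace_fin_two, Matrix.trace_fin_two]
    simp only [map_sub, Derivation.leibniz, smul_eq_mul]
    linear_combination T 1 1 * entry 0 0 + T 0 0 * entry 1 1
      - T 1 0 * entry 0 1 - T 0 1 * entry 1 0
  have hunit : IsUnit T.det := isUnit_iff_constantCoeff.2 hT
  exact (hunit.dvd_mul_right).1 ⟨_, hdet.symm⟩

theorem constantCoeff_sub_eq_mul_coeff {n : ℕ} {ρ : R} {x φ ψ : R⟦X⟧}
    (hx : X ^ 2 * derivative R x + X ^ (n + 1) * φ = X ^ (n + 1) * ψ + C ρ * X * x) :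
    constantCoeff φ - constantCoeff ψ = (ρ - n) * coeff n x := by
  have hX : X * derivative R x + X ^ n * φ = X ^ n * ψ + C ρ * x :=
    X_mul_cancel (by linear_combination hx)
  have hn := congrArg (coeff n) hX
  simp only [map_add, coeff_X_mul_derivative, coeff_X_pow_mul', le_refl, ↓reduceIte, tsub_self,
    coeff_zero_eq_constantCoeff, coeff_C_mul] at hn
  linear_combination hn

/-- The matrix `β C₁ + w C₂ - z σ D + z u E`, with scalar part `β`. -/
def connMatrix (β σ u w : R⟦X⟧) : Matrix (Fin 2) (Fin 2) R⟦X⟧ :=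
  !![β - X * σ, X * u; w, β + X * σ]

end PowerSeriesGauge

section TriangularGauge

variable {K : Type*} [Field K] {μ σ σ' : K} {u w u' w' : K⟦X⟧}

/-- A matrix `T = !![a, z b; c, d]` with `T⁽⁰⁾` lower triangular, `d⁽⁰⁾ = μ a⁽⁰⁾`, solving
`z² T' + B T = T B'` for `B = connMatrix β σ u w` and `B' = connMatrix β σ' u' w'`; the equations
are the entries of this matrix equation, divided by `z` in the first row. -/
structure TriangularGauge (μ σ σ' : K) (u w u' w' : K⟦X⟧) where
  (a b c d : K⟦X⟧)
  ratio : μ ≠ 0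
  corner : constantCoeff a ≠ 0
  diag : constantCoeff d = μ * constantCoeff a
  eq₀₀ : X * derivative K a + C (σ' - σ) * a + u * c = w' * b
  eq₀₁ : X ^ 2 * derivative K b + u * d = u' * a + C (σ + σ' - 1) * X * b
  eq₁₀ : X ^ 2 * derivative K c + w * a = w' * d + C (-(σ + σ')) * X * c

theorem nonempty_triangularGauge {β : K⟦X⟧} {T : Matrix (Fin 2) (Fin 2) K⟦X⟧}
    (hT : IsLeadTriangular μ (T.map constantCoeff))
    (hTB : (X ^ 2 : K⟦X⟧) • T.map (derivative K) + connMatrix β (C σ) u w * T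
      = T * connMatrix β (C σ') u' w') :
    Nonempty (TriangularGauge μ σ σ' u w u' w') := by
  have entry (i j) := congrFun₂ hTB i j
  simp only [connMatrix, Matrix.add_apply, Matrix.smul_apply, Matrix.map_apply, smul_eq_mul,
    Matrix.mul_apply, Fin.sum_univ_two] at entry
  obtain ⟨b, hb⟩ := X_dvd_iff.2 hT.upper
  have e₀₀ := entry 0 0
  have e₀₁ := entry 0 1
  have e₁₀ := entry 1 0
  simp only [Matrix.of_apply, Matrix.cons_val', Matrix.cons_val_zero, Matrix.cons_val_fin_one,
    Matrix.cons_val_one, hb, Derivation.leibniz, smul_eq_mul, derivative_X, mul_one]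
    at e₀₀ e₀₁ e₁₀
  refine ⟨⟨T 0 0, b, T 1 0, T 1 1, hT.ratio, hT.corner, hT.diag, ?_, ?_, ?_⟩⟩
  · refine mul_left_cancel₀ X_ne_zero ?_
    simp only [map_sub]
    linear_combination e₀₀
  · refine mul_left_cancel₀ X_ne_zero ?_
    simp only [map_sub, map_add, map_one]
    linear_combination e₀₁
  · simp only [map_add, map_neg]
    linear_combination e₁₀

namespace TriangularGauge

theorem constantCoeff_lower (G : TriangularGauge μ σ σ' u w u' w') :
    constantCoeff w = μ * constantCoeff w' := by
  have h : constantCoeff w * constantCoeff G.a = constantCoeff w' * constantCoeff G.d := by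
    simpa using congrArg constantCoeff G.eq₁₀
  refine mul_right_cancel₀ G.corner ?_
  linear_combination h + constantCoeff w' * G.diag

theorem exponent_eq (G : TriangularGauge μ σ σ' u w u' w') (hu : constantCoeff u = 0)
    (hwb : constantCoeff w' * constantCoeff G.b = 0) : σ = σ' := by
  have h : (σ' - σ) * constantCoeff G.a = 0 := by
    simpa [hu, hwb] using congrArg constantCoeff G.eq₀₀
  exact (sub_eq_zero.1 ((mul_eq_zero.1 h).resolve_right G.corner)).symm

theorem exponent_eq_or_add_eq_one {v v' : K⟦X⟧}
    (G : TriangularGauge μ σ σ' (X * v) w (X * v') w') (hv : constantCoeff v = 0)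
    (hv' : constantCoeff v' = 0) : σ = σ' ∨ σ + σ' = 1 := by
  have h := constantCoeff_sub_eq_mul_coeff (n := 0) (x := G.b) (φ := v * G.d) (ψ := v' * G.a)
    (by linear_combination G.eq₀₁)
  have hb : (σ + σ' - 1) * constantCoeff G.b = 0 := by simpa [hv, hv'] using h.symm
  refine (mul_eq_zero.1 hb).symm.imp (fun hb => ?_) sub_eq_zero.1
  exact G.exponent_eq (by simp) (by simp [hb])

theorem upper_resonance {n : ℕ} {v v' : K⟦X⟧}
    (G : TriangularGauge μ σ σ' (X ^ (n + 1) * v) w (X ^ (n + 1) * v') w')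
    (hσ : σ + σ' = n + 1) : μ * constantCoeff v = constantCoeff v' := by
  have h := constantCoeff_sub_eq_mul_coeff (x := G.b) (φ := v * G.d) (ψ := v' * G.a)
    (by linear_combination G.eq₀₁)
  simp only [map_mul] at h
  refine mul_right_cancel₀ G.corner ?_
  linear_combination h + hσ * coeff n G.b - constantCoeff v * G.diag

theorem lower_resonance {n : ℕ} {v v' : K⟦X⟧}
    (G : TriangularGauge μ σ σ' u (X ^ (n + 1) * v) u' (X ^ (n + 1) * v'))
    (hσ : σ + σ' = -n) : constantCoeff v = μ * constantCoeff v' := by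
  have h := constantCoeff_sub_eq_mul_coeff (x := G.c) (φ := v * G.a) (ψ := v' * G.d)
    (by linear_combination G.eq₁₀)
  simp only [map_mul] at h
  refine mul_right_cancel₀ G.corner ?_
  linear_combination h - hσ * coeff n G.c + constantCoeff v' * G.diag

end TriangularGauge

end TriangularGauge

namespace NormalForm

/-- The constant `c` of a normal form. -/
def cst : NormalForm → ℂ
  | i c _ _ | ii c _ _ _ | iii1 c _ | iii2 c _ | iii3 c _ _ _ | iii4 c _ _ _ | iii5 c _ _ _ _
  | iii6 c _ _ _ | iii7 c _ _ _ | iii8 c _ _ _ | iii9 c _ _ _ => c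

/-- The constant `α` of a normal form. -/
def alpha : NormalForm → ℂ
  | i _ α _ | ii _ α _ _ | iii1 _ α | iii2 _ α | iii3 _ α _ _ | iii4 _ α _ _ | iii5 _ α _ _ _
  | iii6 _ α _ _ | iii7 _ α _ _ | iii8 _ α _ _ | iii9 _ α _ _ => α

/-- The function `f` with `A₂ = C₂ + z f E`. -/
def coeffE : NormalForm → (Fin 2 → ℂ) → ℂ
  | i _ _ _ => fun _ => 1
  | ii _ _ r _ => fun t => t 1 ^ r
  | _ => 0

/-- The coefficient of `t₂` in the coefficient of `C₂` in `B`; it is `λ` for the forms (iii). -/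
def slope : NormalForm → ℂ
  | i _ _ _ => -1 / 2
  | ii _ _ r _ => -1 / (r + 2)
  | iii1 _ _ | iii2 _ _ => 0
  | iii3 _ _ l _ | iii4 _ _ l _ => l
  | iii5 _ _ _ n _ | iii6 _ _ n _ | iii7 _ _ n _ => n
  | iii8 _ _ n _ | iii9 _ _ n _ => -n

/-- The coefficient of `t₂ ^ 0` in the coefficient of `C₂` in `B`. -/
def lower : NormalForm → ℂ⟦X⟧
  | i _ _ c₀ => C c₀
  | iii4 _ _ _ _ | iii5 _ _ _ _ _ => 1
  | iii8 _ _ n _ => X ^ n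
  | _ => 0

/-- The coefficient of `t₂ ^ 2` in the coefficient of `C₂` in `B`. -/
def quad : NormalForm → ℂ⟦X⟧
  | iii2 _ _ => 1
  | iii5 _ _ γ n _ => C γ * X ^ n
  | iii6 _ _ n _ => X ^ n
  | _ => 0

/-- The coefficient of `C₂` in `B`, at the point `t`. -/
def coeffC₂ (P : NormalForm) (t : Fin 2 → ℂ) : ℂ⟦X⟧ :=
  P.lower + C P.slope * C (t 1) + P.quad * C (t 1) ^ 2

theorem toTE_A (P : NormalForm) : P.toTE.A = formA P.coeffE := by
  have hA₂ : P.A₂ = C₂ + (z * C P.coeffE) • E := by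
    have hone : (C fun _ => 1 : FSeries 2) = 1 := map_one C
    have hpow (r : ℕ) : (C fun t => t 1 ^ r : FSeries 2) = t₂ ^ r := map_pow C _ _
    cases P <;> simp [A₂, coeffE, hone, hpow]
  simp only [toTE, formA, hA₂]

section Evaluation

variable (P : NormalForm) (t : Fin 2 → ℂ)

theorem ev_two_mul_C_half : ev t 2 * C 2⁻¹ = 1 := by
  simpa using congrArg (ev t) kk_half

theorem C_half_slope_add_one (l : ℂ) : (C ((l + 1) / 2) : ℂ⟦X⟧) = C 2⁻¹ * (C l + 1) := by
  rw [div_eq_inv_mul, map_mul, map_add, map_one]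

theorem half_slope_ii_add_one (r : ℕ) :
    ((-1 / (r + 2) + 1) / 2 : ℂ) = (r + 1) / (2 * (r + 2)) := by
  have hr : (r + 2 : ℂ) ≠ 0 := mod_cast (r + 1).succ_ne_zero
  field_simp
  ring

attribute [local simp] B C₁ C₂ D E t₁ t₂ z cst alpha coeffE slope lower quad coeffC₂
  half_slope_ii_add_one

theorem ev_B_zero_zero : ev t (P.B 0 0) = C (P.cst - t 0) + C P.alpha * X
    - X * (C ((P.slope + 1) / 2) + P.quad * C (t 1)) := by
  cases P with
  | i c α c₀ => norm_num; ring
  | ii c α r => simp; ring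
  | iii5 c α γ n =>
    simp only [B, slope, C_half_slope_add_one]
    linear_combination (norm := (simp; ring)) -X * C γ * X ^ n * C (t 1) * ev_two_mul_C_half t
  | iii6 c α n =>
    simp only [B, slope, C_half_slope_add_one]
    linear_combination (norm := (simp; ring)) -X * X ^ n * C (t 1) * ev_two_mul_C_half t
  | _ => simp only [B, slope, C_half_slope_add_one]; simp; ring

theorem ev_B_one_one : ev t (P.B 1 1) = C (P.cst - t 0) + C P.alpha * X
    + X * (C ((P.slope + 1) / 2) + P.quad * C (t 1)) := by
  cases P with
  | i c α c₀ => norm_num; ring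
  | ii c α r => simp; ring
  | iii5 c α γ n =>
    simp only [B, slope, C_half_slope_add_one]
    linear_combination (norm := (simp; ring)) X * C γ * X ^ n * C (t 1) * ev_two_mul_C_half t
  | iii6 c α n =>
    simp only [B, slope, C_half_slope_add_one]
    linear_combination (norm := (simp; ring)) X * X ^ n * C (t 1) * ev_two_mul_C_half t
  | _ => simp only [B, slope, C_half_slope_add_one]; simp; ring

theorem ev_B_one_zero : ev t (P.B 1 0) = P.coeffC₂ t := by
  cases P <;> simp [neg_div] <;> ring

theorem ev_B_zero_one :
    ev t (P.B 0 1) = X * (C (P.coeffE t) * P.coeffC₂ t - X * P.quad) := by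
  cases P <;> simp [neg_div] <;> ring

theorem evM_B : evM t P.B = connMatrix (C (P.cst - t 0) + C P.alpha * X)
    (C ((P.slope + 1) / 2) + P.quad * C (t 1))
    (C (P.coeffE t) * P.coeffC₂ t - X * P.quad) (P.coeffC₂ t) := by
  ext1 a b
  fin_cases a <;> fin_cases b
  exacts [P.ev_B_zero_zero t, P.ev_B_zero_one t, P.ev_B_one_zero t, P.ev_B_one_one t]

end Evaluation

end NormalForm

namespace NormalForm

/-- The coefficient of `z E` in `B`, at the origin. -/
def upper (P : NormalForm) : ℂ⟦X⟧ := C (P.coeffE 0) * P.lower - X * P.quad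

theorem toTE_B (P : NormalForm) : P.toTE.B = P.B := rfl

theorem evM_zero_B (P : NormalForm) : evM 0 P.B =
    connMatrix (C P.cst + C P.alpha * X) (C ((P.slope + 1) / 2)) P.upper P.lower := by
  simp [evM_B, coeffC₂, upper]

theorem lead_B (P : NormalForm) (t : Fin 2 → ℂ) : lead t P.B =
    !![P.cst - t 0, 0; constantCoeff (P.coeffC₂ t), P.cst - t 0] := by
  ext1 a b
  rw [lead_apply, evM_B]
  fin_cases a <;> fin_cases b <;> simp [connMatrix]

theorem toTE_same {P Q : NormalForm} (hcst : P.cst = Q.cst) (halpha : P.alpha = Q.alpha)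
    (hE : P.coeffE = Q.coeffE) (hslope : P.slope = Q.slope) (hlower : P.lower = Q.lower)
    (hquad : P.quad = Q.quad) : P.toTE.Same Q.toTE :=
  ⟨fun i => .of_eq (by rw [toTE_A, toTE_A, hE]), .of_eventually_evM <| .of_forall fun t => by
    simp only [toTE_B, evM_B, coeffC₂, hcst, halpha, hE, hslope, hlower, hquad]⟩

end NormalForm

namespace IsFormalIso

variable {P Q : NormalForm} {h : (Fin 2 → ℂ) → Fin 2 → ℂ} {T : FMat 2 2}

theorem cst_eq_and_alpha_eq (H : IsFormalIso P.toTE Q.toTE h T) :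
    P.cst = Q.cst ∧ P.alpha = Q.alpha := by
  have hdet : constantCoeff (evM 0 T).det ≠ 0 := by
    rw [RingHom.map_det]
    exact H.lead_zero_det_ne_zero
  have hdvd := X_sq_dvd_trace_sub_of_gauge hdet.isUnit H.origin_z
  simp only [NormalForm.toTE_B, NormalForm.evM_zero_B, connMatrix, Matrix.trace_fin_two_of] at hdvd
  rw [X_pow_dvd_iff] at hdvd
  have h₀ : Q.cst + Q.cst - (P.cst + P.cst) = 0 := by simpa using hdvd 0 two_pos
  have h₁ : Q.alpha + Q.alpha - (P.alpha + P.alpha) = 0 := by simpa using hdvd 1 one_lt_two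
  constructor
  · linear_combination -h₀ / 2
  · linear_combination -h₁ / 2

theorem isLeadTriangular_zero (H : IsFormalIso P.toTE Q.toTE h T) :
    IsLeadTriangular (fibreDeriv h 0) (lead 0 T) := by
  simpa only [H.bihol.2.1] using
    (H.eventually_lead_triangular P.toTE_A Q.toTE_A).self_of_nhds.2

theorem fibreDeriv_zero_sq_mul_coeffE (H : IsFormalIso P.toTE Q.toTE h T) :
    fibreDeriv h 0 ^ 2 * P.coeffE 0 = Q.coeffE 0 := by
  simpa only [H.bihol.2.1] using
    (H.eventually_fibreDeriv_sq_mul P.toTE_A Q.toTE_A).self_of_nhds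

theorem nonempty_gauge (H : IsFormalIso P.toTE Q.toTE h T) :
    Nonempty (TriangularGauge (fibreDeriv h 0) ((P.slope + 1) / 2) ((Q.slope + 1) / 2)
      P.upper P.lower Q.upper Q.lower) := by
  refine nonempty_triangularGauge (T := evM 0 T) (β := C P.cst + C P.alpha * X)
    H.isLeadTriangular_zero ?_
  have hz := H.origin_z
  simp only [NormalForm.toTE_B, NormalForm.evM_zero_B] at hz
  rwa [← H.cst_eq_and_alpha_eq.1, ← H.cst_eq_and_alpha_eq.2] at hz

end IsFormalIso

theorem eq_of_C_mul_eq {K : Type*} [Field K] {μ : K} {f g : K⟦X⟧} (hμ : μ ≠ 0)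
    (hf : f = 0 ∨ ∃ n, f = X ^ n) (hg : g = 0 ∨ ∃ n, g = X ^ n) (hfg : C μ * f = g) : f = g := by
  have hμC : (C μ : K⟦X⟧) ≠ 0 := by simpa using hμ
  obtain rfl | ⟨n, rfl⟩ := hf
  · rw [← hfg, mul_zero]
  obtain rfl | ⟨k, rfl⟩ := hg
  · exact (mul_eq_zero.1 hfg).resolve_left hμC
  · have hk : k = n := by
      by_contra hne
      have hcoeff := congrArg (coeff k) hfg
      simp [coeff_X_pow, hne] at hcoeff
    rw [hk]

theorem exists_apply_ne_zero {m : ℕ} {p : (Fin m → ℂ) → Prop} (hp : ∀ᶠ t in 𝓝 0, p t) (i : Fin m) :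
    ∃ t, t i ≠ 0 ∧ p t := by
  have hcurve : Filter.Tendsto (fun (x : ℂ) (_ : Fin m) => x) (𝓝[≠] 0) (𝓝 0) :=
    ((continuous_pi fun _ => continuous_id).tendsto' 0 0 rfl).mono_left nhdsWithin_le_nhds
  obtain ⟨x, hx, hx₀⟩ := ((hcurve.eventually hp).and eventually_mem_nhdsWithin).exists
  exact ⟨fun _ => x, hx₀, hx⟩

namespace NormalForm

variable {P : NormalForm}

theorem eq_i_or_eq_ii (hE : P.coeffE ≠ 0) :
    (∃ c α c₀, P = i c α c₀) ∨ ∃ c α r hr, P = ii c α r hr := by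
  cases P with
  | i => exact .inl ⟨_, _, _, rfl⟩
  | ii => exact .inr ⟨_, _, _, _, rfl⟩
  | _ => exact absurd rfl hE

theorem coeffE_eq_zero_of_eventually (hE : ∀ᶠ t in 𝓝 0, P.coeffE t = 0) : P.coeffE = 0 := by
  by_contra hne
  obtain ⟨t, ht, hEt⟩ := exists_apply_ne_zero hE 1
  obtain ⟨c, α, c₀, rfl⟩ | ⟨c, α, r, hr, rfl⟩ := eq_i_or_eq_ii hne
  · exact one_ne_zero hEt
  · exact pow_ne_zero r ht hEt

theorem exists_quad_eq {n : ℕ} (hn : P.slope = n) : ∃ κ, P.quad = C κ * X ^ n := by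
  cases P with
  | iii2 =>
    obtain rfl : n = 0 := Nat.cast_eq_zero.1 hn.symm
    exact ⟨1, by simp [quad]⟩
  | iii5 _ _ γ k =>
    obtain rfl : k = n := Nat.cast_inj.1 hn
    exact ⟨γ, rfl⟩
  | iii6 _ _ k =>
    obtain rfl : k = n := Nat.cast_inj.1 hn
    exact ⟨1, by simp [quad]⟩
  | _ => exact ⟨0, by simp [quad]⟩

theorem quad_eq_zero (hs : ∀ n : ℕ, P.slope ≠ n) : P.quad = 0 := by
  cases P with
  | iii2 => exact absurd Nat.cast_zero.symm (hs 0)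
  | iii5 _ _ _ n | iii6 _ _ n => exact absurd rfl (hs n)
  | _ => rfl

theorem exists_lower_eq {n : ℕ} (hl : constantCoeff P.lower = 0) (hn : P.slope = -(n + 1)) :
    ∃ ε, P.lower = C ε * X ^ (n + 1) := by
  cases P with
  | iii8 _ _ k =>
    obtain rfl : k = n + 1 := Nat.cast_inj (R := ℂ).1 (by simpa using neg_inj.1 hn)
    exact ⟨1, by simp [lower]⟩
  | _ => exact ⟨0, by simp_all [lower]⟩

theorem lower_eq_zero (hl : constantCoeff P.lower = 0) (hs : ∀ n : ℕ, P.slope ≠ -(n + 1)) :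
    P.lower = 0 := by
  cases P with
  | iii8 _ _ k hk =>
    obtain ⟨n, rfl⟩ := Nat.exists_eq_add_of_le' hk
    exact absurd (by simp [slope]) (hs n)
  | _ => simp_all [lower]

theorem lower_eq_zero_or_eq_X_pow (hE : P.coeffE = 0) : P.lower = 0 ∨ ∃ n, P.lower = X ^ n := by
  cases P with
  | i => simpa [coeffE] using congrFun hE 0
  | iii4 | iii5 => exact .inr ⟨0, rfl⟩
  | iii8 _ _ n => exact .inr ⟨n, rfl⟩
  | _ => exact .inl rfl

theorem quad_eq_zero_or_eq_X_pow (hl : constantCoeff P.lower = 0) :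
    P.quad = 0 ∨ ∃ n, P.quad = X ^ n := by
  cases P with
  | iii2 => exact .inr ⟨0, rfl⟩
  | iii5 => simp [lower] at hl
  | iii6 _ _ n => exact .inr ⟨n, rfl⟩
  | _ => exact .inl rfl

theorem eq_iii4_or_eq_iii5 (hE : P.coeffE = 0) (hl : constantCoeff P.lower ≠ 0) :
    (∃ c α l hl, P = iii4 c α l hl) ∨ ∃ c α γ n hn, P = iii5 c α γ n hn := by
  cases P with
  | i => simpa [coeffE] using congrFun hE 0
  | iii4 => exact .inl ⟨_, _, _, _, rfl⟩
  | iii5 => exact .inr ⟨_, _, _, _, _, rfl⟩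
  | iii8 _ _ n hn => simp [lower, (Nat.zero_lt_of_lt hn).ne'] at hl
  | _ => simp [lower] at hl

theorem constantCoeff_quad_eq_zero (hl : constantCoeff P.lower ≠ 0) :
    constantCoeff P.quad = 0 := by
  cases P with
  | iii5 _ _ γ n hn => simp [quad, (Nat.zero_lt_of_lt hn).ne']
  | iii2 | iii6 => simp [lower] at hl
  | _ => simp [quad]

theorem lower_eq_one (hE : P.coeffE = 0) (hl : constantCoeff P.lower ≠ 0) : P.lower = 1 := by
  obtain ⟨_, _, _, _, rfl⟩ | ⟨_, _, _, _, _, rfl⟩ := eq_iii4_or_eq_iii5 hE hl <;> rfl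

theorem upper_eq_X_mul (hE : P.coeffE = 0) : P.upper = X * -P.quad := by
  simp [upper, hE]

/-- The pairs of normal forms which are isomorphic, but not gauge isomorphic unless they agree. -/
inductive Mirror : NormalForm → NormalForm → Prop
  | i (c α c₀ : ℂ) : Mirror (.i c α c₀) (.i c α (-c₀))
  | iii4 (c α l : ℂ) (hl : ¬ ∃ n : ℤ, n ≠ 0 ∧ l = n) (hl' : ¬ ∃ n : ℤ, n ≠ 0 ∧ -l = n) :
      Mirror (.iii4 c α l hl) (.iii4 c α (-l) hl')

end NormalForm

open NormalForm

namespace IsFormalIso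

variable {P Q : NormalForm} {h : (Fin 2 → ℂ) → Fin 2 → ℂ} {T : FMat 2 2}

theorem fibreDeriv_zero_ne_zero (H : IsFormalIso P.toTE Q.toTE h T) : fibreDeriv h 0 ≠ 0 :=
  H.isLeadTriangular_zero.ratio

theorem coeffE_eq_zero_iff (H : IsFormalIso P.toTE Q.toTE h T) :
    P.coeffE = 0 ↔ Q.coeffE = 0 := by
  have hPQ := H.eventually_eq_zero_iff P.toTE_A Q.toTE_A
  constructor
  · exact fun hP => coeffE_eq_zero_of_eventually (hPQ.1 (.of_forall (congrFun hP)))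
  · exact fun hQ => coeffE_eq_zero_of_eventually (hPQ.2 (.of_forall (congrFun hQ)))

theorem constantCoeff_lower_eq_zero_iff (H : IsFormalIso P.toTE Q.toTE h T) :
    constantCoeff P.lower = 0 ↔ constantCoeff Q.lower = 0 := by
  obtain ⟨G⟩ := H.nonempty_gauge
  rw [G.constantCoeff_lower, mul_eq_zero, or_iff_right H.fibreDeriv_zero_ne_zero]

theorem same_or_mirror_of_i {c α c₀ c' α' c₀' : ℂ}
    (H : IsFormalIso (i c α c₀).toTE (i c' α' c₀').toTE h T) :
    (i c α c₀).toTE.Same (i c' α' c₀').toTE ∨ Mirror (i c α c₀) (i c' α' c₀') := by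
  obtain ⟨rfl, rfl⟩ : c = c' ∧ α = α' := H.cst_eq_and_alpha_eq
  obtain ⟨G⟩ := H.nonempty_gauge
  have hlower : c₀ = fibreDeriv h 0 * c₀' := by simpa [lower] using G.constantCoeff_lower
  have hsq : fibreDeriv h 0 ^ 2 = 1 := by
    simpa [coeffE] using H.fibreDeriv_zero_sq_mul_coeffE
  obtain hμ | hμ := mul_self_eq_one_iff.1 ((pow_two _).symm.trans hsq)
  · left
    rw [hlower, hμ, one_mul]
    exact toTE_same rfl rfl rfl rfl rfl rfl
  · right
    obtain rfl : c₀' = -c₀ := by rw [hlower, hμ]; ring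
    exact .i c α c₀

theorem same_of_ii {c α c' α' : ℂ} {r r' : ℕ} {hr : 1 ≤ r} {hr' : 1 ≤ r'}
    (H : IsFormalIso (ii c α r hr).toTE (ii c' α' r' hr').toTE h T) :
    (ii c α r hr).toTE.Same (ii c' α' r' hr').toTE := by
  obtain ⟨rfl, rfl⟩ : c = c' ∧ α = α' := H.cst_eq_and_alpha_eq
  obtain ⟨G⟩ := H.nonempty_gauge
  have hslope := G.exponent_eq (by simp [upper, lower, quad]) (by simp [lower])
  simp only [NormalForm.slope, half_slope_ii_add_one] at hslope
  have hr₀ : (r + 2 : ℂ) ≠ 0 := mod_cast (r + 1).succ_ne_zero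
  have hr₀' : (r' + 2 : ℂ) ≠ 0 := mod_cast (r' + 1).succ_ne_zero
  field_simp at hslope
  obtain rfl : r = r' := Nat.cast_inj (R := ℂ).1 (by linear_combination hslope)
  exact toTE_same rfl rfl rfl rfl rfl rfl

theorem same_or_mirror_of_coeffE_ne_zero (H : IsFormalIso P.toTE Q.toTE h T)
    (hE : P.coeffE ≠ 0) : P.toTE.Same Q.toTE ∨ Mirror P Q := by
  have hsq := H.fibreDeriv_zero_sq_mul_coeffE
  obtain ⟨c, α, c₀, rfl⟩ | ⟨c, α, r, hr, rfl⟩ := eq_i_or_eq_ii hE <;>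
    obtain ⟨c', α', c₀', rfl⟩ | ⟨c', α', r', hr', rfl⟩ :=
      eq_i_or_eq_ii (H.coeffE_eq_zero_iff.not.1 hE)
  · exact H.same_or_mirror_of_i
  · simp [coeffE, H.fibreDeriv_zero_ne_zero, (Nat.zero_lt_of_lt hr').ne'] at hsq
  · simp [coeffE, (Nat.zero_lt_of_lt hr).ne'] at hsq
  · exact .inl H.same_of_ii

theorem slope_eq_of_lower (H : IsFormalIso P.toTE Q.toTE h T) (hE : P.coeffE = 0)
    (hl : constantCoeff P.lower = 0) : P.slope = Q.slope := by
  obtain ⟨G⟩ := H.nonempty_gauge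
  have hσ := G.exponent_eq (by simp [upper_eq_X_mul hE])
    (by rw [H.constantCoeff_lower_eq_zero_iff.1 hl, zero_mul])
  linear_combination 2 * hσ

theorem slope_eq_or_mirror_of_lower (H : IsFormalIso P.toTE Q.toTE h T) (hE : P.coeffE = 0)
    (hl : constantCoeff P.lower ≠ 0) : P.slope = Q.slope ∨ Mirror P Q := by
  obtain ⟨G⟩ := H.nonempty_gauge
  have hE' := H.coeffE_eq_zero_iff.1 hE
  have hl' := H.constantCoeff_lower_eq_zero_iff.not.1 hl
  rw [upper_eq_X_mul hE, upper_eq_X_mul hE'] at G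
  obtain hσ | hσ := G.exponent_eq_or_add_eq_one (by simp [constantCoeff_quad_eq_zero hl])
    (by simp [constantCoeff_quad_eq_zero hl'])
  · left
    linear_combination 2 * hσ
  right
  have hneg : Q.slope = -P.slope := by linear_combination 2 * hσ
  obtain ⟨hcst, halpha⟩ := H.cst_eq_and_alpha_eq
  obtain ⟨c, α, l, hint, rfl⟩ | ⟨c, α, γ, n, hn, rfl⟩ := eq_iii4_or_eq_iii5 hE hl <;>
    obtain ⟨c', α', l', hint', rfl⟩ | ⟨c', α', γ', n', hn', rfl⟩ := eq_iii4_or_eq_iii5 hE' hl'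
  · obtain ⟨rfl, rfl, rfl⟩ : c = c' ∧ α = α' ∧ l' = -l := ⟨hcst, halpha, hneg⟩
    exact .iii4 c α l hint hint'
  · have hl : l = -n' := neg_eq_iff_eq_neg.1 hneg.symm
    exact absurd ⟨-n', by lia, by simpa using hl⟩ hint
  · have hl' : l' = -n := hneg
    exact absurd ⟨-n, by lia, by simpa using hl'⟩ hint'
  · have hsum : (n' : ℂ) + n = 0 := eq_neg_iff_add_eq_zero.1 hneg
    norm_cast at hsum
    lia

theorem C_fibreDeriv_mul_quad (H : IsFormalIso P.toTE Q.toTE h T) (hE : P.coeffE = 0)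
    (hs : P.slope = Q.slope) : C (fibreDeriv h 0) * P.quad = Q.quad := by
  obtain ⟨G⟩ := H.nonempty_gauge
  by_cases hn : ∃ n : ℕ, P.slope = n
  · obtain ⟨n, hn⟩ := hn
    obtain ⟨κ, hκ⟩ := exists_quad_eq hn
    obtain ⟨κ', hκ'⟩ := exists_quad_eq (hs.symm.trans hn)
    have hP : P.upper = X ^ (n + 1) * C (-κ) := by
      rw [upper_eq_X_mul hE, hκ, map_neg]
      ring
    have hQ : Q.upper = X ^ (n + 1) * C (-κ') := by
      rw [upper_eq_X_mul (H.coeffE_eq_zero_iff.1 hE), hκ', map_neg]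
      ring
    rw [hP, hQ] at G
    have hμ : fibreDeriv h 0 * κ = κ' := by
      simpa using G.upper_resonance (by rw [← hs, hn]; ring)
    rw [hκ, hκ', ← hμ, map_mul, mul_assoc]
  · rw [quad_eq_zero (not_exists.1 hn), quad_eq_zero (hs ▸ not_exists.1 hn), mul_zero]

theorem C_fibreDeriv_mul_lower (H : IsFormalIso P.toTE Q.toTE h T)
    (hl : constantCoeff P.lower = 0) (hs : P.slope = Q.slope) :
    C (fibreDeriv h 0) * Q.lower = P.lower := by
  obtain ⟨G⟩ := H.nonempty_gauge
  have hl' := H.constantCoeff_lower_eq_zero_iff.1 hl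
  by_cases hn : ∃ n : ℕ, P.slope = -(n + 1)
  · obtain ⟨n, hn⟩ := hn
    obtain ⟨ε, hε⟩ := exists_lower_eq hl hn
    obtain ⟨ε', hε'⟩ := exists_lower_eq hl' (hs.symm.trans hn)
    rw [hε, hε', mul_comm, mul_comm (C ε')] at G
    have hμ : ε = fibreDeriv h 0 * ε' := by
      simpa using G.lower_resonance (by rw [← hs, hn]; ring)
    rw [hε, hε', hμ, map_mul, mul_assoc]
  · rw [lower_eq_zero hl (not_exists.1 hn), lower_eq_zero hl' (hs ▸ not_exists.1 hn), mul_zero]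

theorem lower_eq_and_quad_eq (H : IsFormalIso P.toTE Q.toTE h T) (hE : P.coeffE = 0)
    (hs : P.slope = Q.slope) : P.lower = Q.lower ∧ P.quad = Q.quad := by
  have hE' := H.coeffE_eq_zero_iff.1 hE
  have hquad := H.C_fibreDeriv_mul_quad hE hs
  by_cases hl : constantCoeff P.lower = 0
  · have hl' := H.constantCoeff_lower_eq_zero_iff.1 hl
    exact ⟨(eq_of_C_mul_eq H.fibreDeriv_zero_ne_zero (lower_eq_zero_or_eq_X_pow hE')
      (lower_eq_zero_or_eq_X_pow hE) (H.C_fibreDeriv_mul_lower hl hs)).symm,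
      eq_of_C_mul_eq H.fibreDeriv_zero_ne_zero (quad_eq_zero_or_eq_X_pow hl)
        (quad_eq_zero_or_eq_X_pow hl') hquad⟩
  · have hP := lower_eq_one hE hl
    have hQ := lower_eq_one hE' (H.constantCoeff_lower_eq_zero_iff.not.1 hl)
    obtain ⟨G⟩ := H.nonempty_gauge
    have hμ : 1 = fibreDeriv h 0 := by simpa [hP, hQ] using G.constantCoeff_lower
    exact ⟨hP.trans hQ.symm, by rw [← hquad, ← hμ, map_one, one_mul]⟩

theorem same_or_mirror (H : IsFormalIso P.toTE Q.toTE h T) :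
    P.toTE.Same Q.toTE ∨ Mirror P Q := by
  by_cases hE : P.coeffE = 0
  · have hslope : P.slope = Q.slope ∨ Mirror P Q := by
      by_cases hl : constantCoeff P.lower = 0
      · exact .inl (H.slope_eq_of_lower hE hl)
      · exact H.slope_eq_or_mirror_of_lower hE hl
    refine hslope.imp_left fun hs => ?_
    obtain ⟨hcst, halpha⟩ := H.cst_eq_and_alpha_eq
    obtain ⟨hlower, hquad⟩ := H.lower_eq_and_quad_eq hE hs
    exact toTE_same hcst halpha (hE.trans (H.coeffE_eq_zero_iff.1 hE).symm) hs hlower hquad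
  · exact H.same_or_mirror_of_coeffE_ne_zero hE

end IsFormalIso

section PartialDerivative

variable {m r : ℕ} {t : Fin m → ℂ}

theorem pdFun_comp_apply {φ : ℂ → ℂ} {φ' : ℂ} {j : Fin m} (hφ : HasDerivAt φ φ' (t j))
    (i : Fin m) : pdFun i (fun s => φ (s j)) t = if j = i then φ' else 0 := by
  have hproj := (ContinuousLinearMap.proj (R := ℂ) (φ := fun _ : Fin m => ℂ) j).hasFDerivAt (x := t)
  have hcomp : HasFDerivAt (fun s : Fin m → ℂ => φ (s j)) _ t := hφ.hasFDerivAt.comp t hproj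
  rw [pdFun, hcomp.fderiv]
  by_cases hj : j = i <;> simp [hj]

theorem ev_pdSeries_C (f : (Fin m → ℂ) → ℂ) (i : Fin m) :
    ev t (pdSeries i (C f)) = C (pdFun i f t) := by
  ext n
  obtain rfl | hn := eq_or_ne n 0
  · simp [pdSeries]
  · simp [pdSeries, pdFun, coeff_C, hn]

theorem evM_pd_congr {F G : FMat m r} (hFG : ∀ᶠ s in 𝓝 t, evM s F = evM s G) (i : Fin m) :
    evM t (pd i F) = evM t (pd i G) := by
  ext a b n
  have hcoeff : coeff n (F a b) =ᶠ[𝓝 t] coeff n (G a b) :=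
    hFG.mono fun s hs => congrArg (coeff n) (congrFun₂ hs a b)
  simp only [evM_apply, coeff_ev, pd, Matrix.map_apply, pdSeries, coeff_mk, pdFun,
    hcoeff.fderiv_eq]

theorem analyticOnNhd_coeff_C {f : (Fin m → ℂ) → ℂ} {U : Set (Fin m → ℂ)}
    (hf : AnalyticOnNhd ℂ f U) (n : ℕ) : AnalyticOnNhd ℂ (coeff n (C f : FSeries m)) U := by
  rw [coeff_C]
  split_ifs
  exacts [hf, analyticOnNhd_const]

end PartialDerivative

section Moebius

variable {ε l s : ℂ} {t : Fin 2 → ℂ}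

/-- The map `(t₁, t₂) ↦ (t₁, ε t₂ / (1 - l t₂))`, used for `ε = ±1`. -/
def moebius (ε l : ℂ) (t : Fin 2 → ℂ) : Fin 2 → ℂ := ![t 0, ε * t 1 / (1 - l * t 1)]

theorem eventually_one_sub_ne_zero (l : ℂ) : ∀ᶠ t in 𝓝 (0 : Fin 2 → ℂ), 1 - l * t 1 ≠ 0 := by
  have hcont : Continuous fun t : Fin 2 → ℂ => 1 - l * t 1 := by fun_prop
  exact hcont.continuousAt.eventually_ne (by simp)

theorem one_add_mul_moebius (hε : ε ^ 2 = 1) (hs : 1 - l * s ≠ 0) :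
    1 + ε * l * (ε * s / (1 - l * s)) = (1 - l * s)⁻¹ := by
  field_simp
  linear_combination l * s * hε

theorem analyticAt_moebius (ε l : ℂ) : AnalyticAt ℂ (moebius ε l) 0 := by
  refine analyticAt_pi_iff.2 fun i => ?_
  have hproj (j : Fin 2) : AnalyticAt ℂ (fun t : Fin 2 → ℂ => t j) 0 :=
    (ContinuousLinearMap.proj (R := ℂ) (φ := fun _ : Fin 2 => ℂ) j).analyticAt 0
  fin_cases i
  · exact hproj 0
  · exact (analyticAt_const.mul (hproj 1)).div
      (analyticAt_const.sub (analyticAt_const.mul (hproj 1))) (by simp)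

theorem moebius_zero (ε l : ℂ) : moebius ε l 0 = 0 := by
  ext i
  fin_cases i <;> simp [moebius]

theorem eventually_moebius_moebius (hε : ε ^ 2 = 1) (l : ℂ) :
    ∀ᶠ t in 𝓝 0, moebius ε (-(ε * l)) (moebius ε l t) = t := by
  filter_upwards [eventually_one_sub_ne_zero l] with t ht
  ext i
  fin_cases i
  · rfl
  · have hinv := one_add_mul_moebius hε ht
    simp only [moebius, Fin.mk_one, Matrix.cons_val_one, Matrix.cons_val_fin_one, neg_mul,
      sub_neg_eq_add, hinv, div_inv_eq_mul]
    rw [mul_assoc, div_mul_cancel₀ _ ht]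
    linear_combination t 1 * hε

theorem isBiholGerm_moebius (hε : ε ^ 2 = 1) (l : ℂ) : IsBiholGerm (moebius ε l) := by
  refine ⟨analyticAt_moebius ε l, moebius_zero ε l, moebius ε (-(ε * l)), analyticAt_moebius _ _,
    moebius_zero _ _, eventually_moebius_moebius hε l, ?_⟩
  have hl : -(ε * -(ε * l)) = l := by linear_combination l * hε
  simpa only [hl] using eventually_moebius_moebius hε (-(ε * l))

theorem hasDerivAt_one_sub_mul (l s : ℂ) : HasDerivAt (fun s => 1 - l * s) (-l) s := by
  simpa using ((hasDerivAt_id s).const_mul l).const_sub 1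

theorem hasDerivAt_moebius (ε : ℂ) (hs : 1 - l * s ≠ 0) :
    HasDerivAt (fun s => ε * s / (1 - l * s)) (ε * (1 - l * s)⁻¹ ^ 2) s := by
  refine (((hasDerivAt_id' s).const_mul ε).div (hasDerivAt_one_sub_mul l s) hs).congr_deriv ?_
  field_simp
  ring

theorem pdFun_moebius_zero (ε l : ℂ) (t : Fin 2 → ℂ) (i : Fin 2) :
    pdFun i (fun s => moebius ε l s 0) t = if 0 = i then 1 else 0 :=
  pdFun_comp_apply (j := 0) (hasDerivAt_id _) i

theorem pdFun_moebius_one (ε : ℂ) (ht : 1 - l * t 1 ≠ 0) (i : Fin 2) :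
    pdFun i (fun s => moebius ε l s 1) t = if 1 = i then ε * (1 - l * t 1)⁻¹ ^ 2 else 0 :=
  pdFun_comp_apply (j := 1) (hasDerivAt_moebius ε ht) i

/-- A gauge transformation which covers `moebius ε l`; in the coordinates before that map it is
`!![1 - l t₂, -l z; 0, ε (1 - l t₂)⁻¹]`. -/
def moebiusGauge (ε l : ℂ) : FMat 2 2 :=
  !![C fun t => (1 + ε * l * t 1)⁻¹, kk (-l) * z; 0, C fun t => ε * (1 + ε * l * t 1)]

theorem isHol_moebiusGauge (ε l : ℂ) : IsHol (moebiusGauge ε l) := by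
  refine ⟨{t | 1 + ε * l * t 1 ≠ 0}, ?_, fun a b n => ?_⟩
  · filter_upwards [eventually_one_sub_ne_zero (-(ε * l))] with t ht
    simpa using ht
  have hlin : AnalyticOnNhd ℂ (fun t : Fin 2 → ℂ => 1 + ε * l * t 1) {t | 1 + ε * l * t 1 ≠ 0} :=
    fun t _ => analyticAt_const.add <| analyticAt_const.mul <|
      (ContinuousLinearMap.proj (R := ℂ) (φ := fun _ : Fin 2 => ℂ) 1).analyticAt t
  fin_cases a <;> fin_cases b
  · exact analyticOnNhd_coeff_C (hlin.inv fun t ht => ht) n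
  · exact (((entire_kk (-l)).mul entire_zz) n).mono (Set.subset_univ _)
  · exact analyticOnNhd_const
  · exact analyticOnNhd_coeff_C (analyticOnNhd_const.mul hlin) n

theorem evM_moebiusGauge (hε : ε ^ 2 = 1) (ht : 1 - l * t 1 ≠ 0) :
    evM (moebius ε l t) (moebiusGauge ε l) =
      !![C (1 - l * t 1), C (-l) * X; 0, C (ε * (1 - l * t 1)⁻¹)] := by
  have hinv := one_add_mul_moebius hε ht
  ext1 a b
  fin_cases a <;> fin_cases b <;> simp [moebiusGauge, moebius, z, hinv]

theorem evM_pd_pullback_moebiusGauge (hε : ε ^ 2 = 1) (ht : 1 - l * t 1 ≠ 0) (i : Fin 2) :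
    evM t (pd i (pullback (moebiusGauge ε l) (moebius ε l))) =
      if 1 = i then !![C (-l), 0; 0, C (ε * l * (1 - l * t 1)⁻¹ ^ 2)] else 0 := by
  have hne : ∀ᶠ s in 𝓝 t, 1 - l * s 1 ≠ 0 := by
    have hcont : Continuous fun t : Fin 2 → ℂ => 1 - l * t 1 := by fun_prop
    exact hcont.continuousAt.eventually_ne ht
  have hG : ∀ᶠ s in 𝓝 t, evM s (pullback (moebiusGauge ε l) (moebius ε l)) =
      evM s !![C fun t => 1 - l * t 1, kk (-l) * z; 0, C fun t => ε * (1 - l * t 1)⁻¹] := by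
    filter_upwards [hne] with s hs
    rw [evM_pullback, evM_moebiusGauge hε hs]
    ext1 a b
    fin_cases a <;> fin_cases b <;> simp [z]
  have hinv : HasDerivAt (fun s => ε * (1 - l * s)⁻¹) (ε * l * (1 - l * t 1)⁻¹ ^ 2) (t 1) := by
    refine (((hasDerivAt_one_sub_mul l (t 1)).fun_inv ht).const_mul ε).congr_deriv ?_
    field_simp
  have hz : pdSeries i (kk (-l) * z) = 0 :=
    (((hasPd_kk (-l)).mul (hasPd_zz (m := 2) (i := i))).congr (by simp)).2
  rw [evM_pd_congr hG]
  ext1 a b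
  fin_cases a <;> fin_cases b <;>
    simp [pd, ev_pdSeries_C, pdFun_comp_apply (hasDerivAt_one_sub_mul l (t 1)),
      pdFun_comp_apply hinv, hz, hasPd_zero.2] <;>
    split_ifs <;> simp

end Moebius

section GaugeMatrix

variable {R : Type*} [CommRing R]

theorem gauge_offDiag_eq {a d d' l μ φ φ' : R} (hd : μ * a = d) (hd' : d' = μ * l)
    (hφ : μ * φ * d = a * φ') :
    (X : R⟦X⟧) • !![C (-l), 0; 0, C d'] +
        C μ • (!![0, X * C φ; 1, 0] * !![C a, C (-l) * X; 0, C d]) =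
      !![C a, C (-l) * X; 0, C d] * !![0, X * C φ'; 1, 0] := by
  have hφC : C μ * C φ * C d = (C a * C φ' : R⟦X⟧) := by simp only [← map_mul, hφ]
  subst hd hd'
  simp only [map_mul, map_neg] at hφC ⊢
  simp only [Matrix.mul_fin_two, Matrix.smul_of, Matrix.smul_cons, Matrix.smul_empty,
    Matrix.of_add_of, Matrix.cons_add_cons, Matrix.empty_add_empty, smul_eq_mul]
  congrm !![?_, ?_; ?_, ?_]
  · ring
  · linear_combination X * hφC
  · ring
  · ring

theorem gauge_connMatrix_eq {a b d β σ u w σ' u' w' : R⟦X⟧} (h₀₀ : a * (σ' - σ) = b * w')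
    (h₀₁ : X * b + u * d = a * u' + X * b * (σ + σ')) (h₁₀ : w * a = d * w')
    (h₁₁ : w * b = d * (σ' - σ)) :
    (X ^ 2 : R⟦X⟧) • !![0, b; 0, 0] + connMatrix β σ u w * !![a, b * X; 0, d] =
      !![a, b * X; 0, d] * connMatrix β σ' u' w' := by
  simp only [connMatrix, Matrix.mul_fin_two, Matrix.smul_of, Matrix.smul_cons, Matrix.smul_empty,
    Matrix.of_add_of, Matrix.cons_add_cons, Matrix.empty_add_empty, smul_eq_mul]
  congrm !![?_, ?_; ?_, ?_]
  · linear_combination X * h₀₀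
  · linear_combination X * h₀₁
  · linear_combination h₁₀
  · linear_combination X * h₁₁

end GaugeMatrix

theorem isFormalIso_moebius {N N' : FormalTE 2 2} {f f' : (Fin 2 → ℂ) → ℂ} {ε l : ℂ}
    (hN : N.A = formA f) (hN' : N'.A = formA f') (hε : ε ^ 2 = 1)
    (hf : ∀ᶠ t in 𝓝 0, (ε * (1 - l * t 1)⁻¹ ^ 2) ^ 2 * f (moebius ε l t) = f' t)
    (hB : ∀ᶠ t in 𝓝 0,
      (X ^ 2 : ℂ⟦X⟧) • !![0, C (-l); 0, 0] +
        evM (moebius ε l t) N.B *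
          !![C (1 - l * t 1), C (-l) * X; 0, C (ε * (1 - l * t 1)⁻¹)] =
        !![C (1 - l * t 1), C (-l) * X; 0, C (ε * (1 - l * t 1)⁻¹)] * evM t N'.B) :
    IsFormalIso N N' (moebius ε l) (moebiusGauge ε l) := by
  have hne := eventually_one_sub_ne_zero l
  refine .of_eventually (isBiholGerm_moebius hε l) (isHol_moebiusGauge ε l) ?_ (fun i => ?_) ?_
  · have hε₀ : ε ≠ 0 := fun h => by simp [h] at hε
    have hT := evM_moebiusGauge (t := 0) hε hne.self_of_nhds
    rw [moebius_zero] at hT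
    have hlead : lead 0 (moebiusGauge ε l) = (evM 0 (moebiusGauge ε l)).map constantCoeff := rfl
    rw [hlead, hT, Matrix.det_fin_two]
    simpa using hε₀
  · filter_upwards [hne, hf] with t ht hft
    rw [evM_pd_pullback_moebiusGauge hε ht, evM_moebiusGauge hε ht, Fin.sum_univ_two, hN, hN',
      evM_formA, evM_formA, evM_formA, pdFun_moebius_zero, pdFun_moebius_one ε ht]
    fin_cases i
    · simp
    · have hgauge := gauge_offDiag_eq (R := ℂ) (a := 1 - l * t 1) (d := ε * (1 - l * t 1)⁻¹)
        (d' := ε * l * (1 - l * t 1)⁻¹ ^ 2) (l := l) (μ := ε * (1 - l * t 1)⁻¹ ^ 2)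
        (φ := f (moebius ε l t)) (φ' := f' t) (by field_simp) (by ring)
        (by rw [← hft]; field_simp)
      simpa using hgauge
  · filter_upwards [hne, hB] with t ht hBt
    rw [evM_moebiusGauge hε ht]
    convert hBt using 3
    ext1 a b
    fin_cases a <;> fin_cases b <;> simp

theorem isFormalIso_i_neg (c α c₀ : ℂ) :
    IsFormalIso (i c α c₀).toTE (i c α (-c₀)).toTE (moebius (-1) 0) (moebiusGauge (-1) 0) := by
  refine isFormalIso_moebius (toTE_A _) (toTE_A _) (by norm_num)
    (.of_forall fun t => by simp [coeffE]) (.of_forall fun t => ?_)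
  rw [toTE_B, toTE_B, evM_B, evM_B]
  refine gauge_connMatrix_eq ?_ ?_ ?_ ?_ <;>
    simp [coeffC₂, moebius, coeffE, NormalForm.slope, lower, quad, add_comm]

theorem isFormalIso_iii4_neg {c α l : ℂ} (hl : ¬ ∃ n : ℤ, n ≠ 0 ∧ l = n)
    (hl' : ¬ ∃ n : ℤ, n ≠ 0 ∧ -l = n) :
    IsFormalIso (iii4 c α l hl).toTE (iii4 c α (-l) hl').toTE (moebius 1 l) (moebiusGauge 1 l) := by
  refine isFormalIso_moebius (toTE_A _) (toTE_A _) (one_pow 2)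
    (.of_forall fun t => by simp [coeffE]) ?_
  filter_upwards [eventually_one_sub_ne_zero l] with t ht
  have hw : (iii4 c α l hl).coeffC₂ (moebius 1 l t) = C (1 - l * t 1)⁻¹ := by
    rw [← one_add_mul_moebius (one_pow 2) ht]
    simp [coeffC₂, NormalForm.slope, lower, quad, moebius]
  have hw' : (iii4 c α (-l) hl').coeffC₂ t = C (1 - l * t 1) := by
    simp [coeffC₂, NormalForm.slope, lower, quad, sub_eq_add_neg]
  rw [toTE_B, toTE_B, evM_B, evM_B, hw, hw']
  simp only [quad, NormalForm.slope, coeffE, Pi.zero_apply, map_zero, zero_mul, mul_zero,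
    add_zero, sub_zero]
  refine gauge_connMatrix_eq ?_ ?_ ?_ ?_
  · rw [← map_sub, ← map_mul, ← map_mul]
    ring_nf
  · rw [← map_add]
    ring_nf
    rw [map_one, mul_one]
  · rw [← map_mul, ← map_mul, one_mul, mul_comm]
  · rw [← map_sub, ← map_mul, ← map_mul]
    ring_nf

variable {P Q : NormalForm}

theorem formallyIso_of_mirror (hPQ : Mirror P Q) : FormallyIso P.toTE Q.toTE := by
  cases hPQ with
  | i c α c₀ => exact ⟨_, _, isFormalIso_i_neg c α c₀⟩
  | iii4 c α l hl hl' => exact ⟨_, _, isFormalIso_iii4_neg hl hl'⟩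

theorem formallyIso_iff_mirror (hS : ¬ P.toTE.Same Q.toTE) :
    FormallyIso P.toTE Q.toTE ↔ Mirror P Q :=
  ⟨fun ⟨_, _, H⟩ => H.same_or_mirror.resolve_left hS, formallyIso_of_mirror⟩

theorem eventually_constantCoeff_coeffC₂_eq {T : FMat 2 2}
    (H : IsFormalIso P.toTE Q.toTE id T) :
    ∀ᶠ t in 𝓝 0, constantCoeff (P.coeffC₂ t) = constantCoeff (Q.coeffC₂ t) := by
  filter_upwards [H.eventually_lower_eq P.toTE_A Q.toTE_A P.lead_B Q.lead_B] with t ht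
  have hid : fibreDeriv id t = 1 := (pdFun_comp_apply (hasDerivAt_id (t 1)) 1).trans (if_pos rfl)
  simpa only [hid, one_mul, id] using ht

theorem same_of_formallyGaugeIso (hG : FormallyGaugeIso P.toTE Q.toTE) :
    P.toTE.Same Q.toTE := by
  obtain ⟨T, H⟩ := hG
  refine H.same_or_mirror.elim id fun hPQ => ?_
  have heq := eventually_constantCoeff_coeffC₂_eq H
  cases hPQ with
  | i c α c₀ =>
    have hc₀ : c₀ = -c₀ := by
      simpa [coeffC₂, lower, quad, NormalForm.slope] using heq.self_of_nhds
    rw [← hc₀]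
    exact toTE_same rfl rfl rfl rfl rfl rfl
  | iii4 c α l hl hl' =>
    obtain ⟨t, ht, heqt⟩ := exists_apply_ne_zero heq 1
    have hlt : l * t 1 = -l * t 1 := by
      simpa [coeffC₂, lower, quad, NormalForm.slope] using heqt
    exact toTE_same rfl rfl rfl (mul_right_cancel₀ ht hlt) rfl rfl

end TEStruct

end

theorem theorem3p2 :
    -- distinct normal forms are formally non-isomorphic, outside the two exceptional cases
    (∀ P Q : TEStruct.NormalForm,
      ¬ P.toTE.Same Q.toTE →
      ¬ (∃ c α c₀ c' α' c₀' : ℂ, c₀ * c₀' ≠ 0 ∧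
          P = TEStruct.NormalForm.i c α c₀ ∧ Q = TEStruct.NormalForm.i c' α' c₀') →
      ¬ (∃ (c α l : ℂ) (hl : ¬ ∃ n : ℤ, n ≠ 0 ∧ l = n)
            (c' α' l' : ℂ) (hl' : ¬ ∃ n : ℤ, n ≠ 0 ∧ l' = n), l * l' ≠ 0 ∧
          P = TEStruct.NormalForm.iii4 c α l hl ∧ Q = TEStruct.NormalForm.iii4 c' α' l' hl') →
      ¬ TEStruct.FormallyIso P.toTE Q.toTE) ∧
    -- first exceptional case: both of the form `i`, with nonzero `c₀`, `c₀'`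
    (∀ c α c₀ c' α' c₀' : ℂ, c₀ * c₀' ≠ 0 →
      ¬ (TEStruct.NormalForm.i c α c₀).toTE.Same (TEStruct.NormalForm.i c' α' c₀').toTE →
      (TEStruct.FormallyIso (TEStruct.NormalForm.i c α c₀).toTE
          (TEStruct.NormalForm.i c' α' c₀').toTE ↔
        c' = c ∧ α' = α ∧ c₀' = -c₀) ∧
      ¬ TEStruct.FormallyGaugeIso (TEStruct.NormalForm.i c α c₀).toTE
          (TEStruct.NormalForm.i c' α' c₀').toTE) ∧
    -- second exceptional case: both of the form `iii4`, with nonzero `l`, `l'`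
    (∀ (c α l : ℂ) (hl : ¬ ∃ n : ℤ, n ≠ 0 ∧ l = n)
        (c' α' l' : ℂ) (hl' : ¬ ∃ n : ℤ, n ≠ 0 ∧ l' = n), l * l' ≠ 0 →
      ¬ (TEStruct.NormalForm.iii4 c α l hl).toTE.Same
          (TEStruct.NormalForm.iii4 c' α' l' hl').toTE →
      (TEStruct.FormallyIso (TEStruct.NormalForm.iii4 c α l hl).toTE
          (TEStruct.NormalForm.iii4 c' α' l' hl').toTE ↔
        c' = c ∧ α' = α ∧ l' = -l) ∧
      ¬ TEStruct.FormallyGaugeIso (TEStruct.NormalForm.iii4 c α l hl).toTE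
          (TEStruct.NormalForm.iii4 c' α' l' hl').toTE) := by
  refine ⟨fun P Q hS hi hiii4 hPQ => ?_,
    fun c α c₀ c' α' c₀' _ hS => ⟨?_, mt TEStruct.same_of_formallyGaugeIso hS⟩,
    fun c α l hl c' α' l' hl' _ hS => ⟨?_, mt TEStruct.same_of_formallyGaugeIso hS⟩⟩
  · cases (TEStruct.formallyIso_iff_mirror hS).1 hPQ with
    | i c α c₀ =>
      refine hi ⟨c, α, c₀, c, α, -c₀, fun h₀ => hS ?_, rfl, rfl⟩
      obtain rfl : c₀ = 0 := by simpa using h₀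
      rw [neg_zero]
      exact TEStruct.NormalForm.toTE_same rfl rfl rfl rfl rfl rfl
    | iii4 c α l hl hl' =>
      refine hiii4 ⟨c, α, l, hl, c, α, -l, hl', fun h₀ => hS ?_, rfl, rfl⟩
      obtain rfl : l = 0 := by simpa using h₀
      exact TEStruct.NormalForm.toTE_same rfl rfl rfl neg_zero.symm rfl rfl
  · rw [TEStruct.formallyIso_iff_mirror hS]
    exact ⟨by rintro ⟨⟩; simp, by rintro ⟨rfl, rfl, rfl⟩; exact .i ..⟩
  · rw [TEStruct.formallyIso_iff_mirror hS]
    exact ⟨by rintro ⟨⟩; simp, by rintro ⟨rfl, rfl, rfl⟩; exact .iii4 ..⟩
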